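/- Let $A,C\in\mathbb{C}^{n\times n}$ be Hermitian with $C$ indefinite. A 2D-eigentriplet of $(A,C)$ is $(\mu,\lambda,x)\in\mathbb{R}\times\mathbb{R}\times\mathbb{C}^n$ with $(A-\mu C)x=\lambda x$, $x^HCx=0$, $x^Hx=1$. Put $$\widehat J(\mu,\lambda,x)=[\,A-\mu C-\lambda I,\ -Cx,\ -x\,],\qquad J(\mu,\lambda,x)=\begin{bmatrix}A-\mu C-\lambda I&-Cx&-x\\-x^HC&0&0\\-x^H&0&0\end{bmatrix}.$$ A 2D-eigentriplet $(\mu_*,\lambda_*,x_*)$ is nonsingular if $J(\mu_*,\lambda_*,x_*)$ is nonsingular, and simple if $\lambda_*$ is an eigenvalue of $A-\mu_*C$ of multiplicity one. One step of the 2D Rayleigh quotient iteration (2DRQI) at $(\mu_k,\lambda_k,x_k)\in\mathbb{R}\times\mathbb{R}\times\mathbb{C}^n$ is as follows. Assume that $J(\mu_k,\lambda_k,x_k)$ is nonsingular. Let $\begin{bmatrix}\widetilde V_k\\R\end{bmatrix}$, with $\widetilde V_k\in\mathbb{C}^{n\times 2}$, be a basis matrix of the null space of $\widehat J(\mu_k,\lambda_k,x_k)$,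 and let the columns of $V_k\in\mathbb{C}^{n\times2}$ be an orthonormal basis of the column space of $\widetilde V_k$, chosen so that $C_k=V_k^HCV_k=\mathrm{diag}(c_{1,k},c_{2,k})$ with $c_{1,k}\ge c_{2,k}$. Let $A_k=V_k^HAV_k=(a_{ij,k})$, and assume that $c_{1,k}>0>c_{2,k}$. Put $$z(\alpha)=\begin{bmatrix}\sqrt{-c_{2,k}/(c_{1,k}-c_{2,k})}\\ \alpha\sqrt{c_{1,k}/(c_{1,k}-c_{2,k})}\end{bmatrix},\quad \nu(\alpha)=\frac{z(\alpha)^HC_kA_kz(\alpha)}{\|C_kz(\alpha)\|^2},\quad \theta(\alpha)=z(\alpha)^HA_kz(\alpha).$$ If $a_{12,k}\neq0$ (the generic case), then $(\mu_{k+1},\lambda_{k+1},x_{k+1})$ is that one of the two 2D-Ritz triplets $(\nu(\alpha),\theta(\alpha),V_kz(\alpha))$, $\alpha=\pm|a_{12,k}|/a_{12,k}$, for which $|\mu_k-\nu(\alpha)|+|\lambda_k-\theta(\alpha)|$ is smaller (either one in case of a tie). If $a_{12,k}=0$, then $$\mu_{k+1}=\frac{a_{11,k}-a_{22,k}}{c_{1,k}-c_{2,k}},\qquad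 \lambda_{k+1}=\frac{a_{22,k}c_{1,k}-a_{11,k}c_{2,k}}{c_{1,k}-c_{2,k}},\qquad x_{k+1}=V_kz(1).$$ **Theorem.** Let $(\mu_*,\lambda_*,x_*)$ be a nonsingular simple 2D-eigentriplet of $(A,C)$, and let $\mathcal X_*$ be the set of all $x$ for which $(\mu_*,\lambda_*,x)$ is a 2D-eigentriplet (so $\mathcal X_*=\{\gamma x_*:\gamma\in\mathbb{C},\ |\gamma|=1\}$). There are constants $\epsilon_0,\kappa_1,\kappa_2,\kappa_3>0$ depending only on $(A,C,\mu_*,\lambda_*)$ such that for all $\mu_k,\lambda_k\in\mathbb{R}$ and $x_k\in\mathbb{C}^n$ with $$\epsilon:=\max\{|\mu_k-\mu_*|,\,|\lambda_k-\lambda_*|,\,\mathrm{dist}(x_k,\mathcal X_*)\}\le\epsilon_0$$ ($\mathrm{dist}$ being the Euclidean distance) the following hold. 1. $J(\mu_k,\lambda_k,x_k)$ is nonsingular and a matrix $V_k$ as above exists. For every such $V_k$ we have $c_{1,k}>0>c_{2,k}$ and $a_{12,k}\ne0$, and one of the two values of $|\mu_k-\nu(\alpha)|+|\lambda_k-\theta(\alpha)|$,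 $\alpha=\pm|a_{12,k}|/a_{12,k}$, is strictly smaller than the other. Hence the step can be carried out, and the new iterate is given by the generic case, the nearer 2D-Ritz triplet being selected. 2. For every such $V_k$, the new iterate satisfies $$|\mu_{k+1}-\mu_*|\le\kappa_1\epsilon^2,\qquad |\lambda_{k+1}-\lambda_*|\le\kappa_2\epsilon^4,\qquad \mathrm{dist}(x_{k+1},\mathcal X_*)\le\kappa_3\epsilon^2,$$ that is, the 2DRQI converges locally quadratically. -/

import Mathlib

open Matrix

noncomputable section

namespace TwoDEVP

/-- A matrix `C` is indefinite if its quadratic form takes both a positive and a negative value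
(used for Hermitian `C`, where `xᴴ C x` is real). -/
def IsIndefinite {n : ℕ} (C : Matrix (Fin n) (Fin n) ℂ) : Prop :=
  (∃ x : Fin n → ℂ, 0 < (star x ⬝ᵥ (C *ᵥ x)).re) ∧ (∃ y : Fin n → ℂ, (star y ⬝ᵥ (C *ᵥ y)).re < 0)

/-- `(μ, lam, x)` is a 2D-eigentriplet of `(A, C)`:
`(A - μ C) x = lam x`, `xᴴ C x = 0`, `xᴴ x = 1`. -/
structure IsEigentriplet {n : ℕ} (A C : Matrix (Fin n) (Fin n) ℂ) (μ lam : ℝ)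
    (x : EuclideanSpace ℂ (Fin n)) : Prop where
  eig : (A - (μ : ℂ) • C) *ᵥ x.ofLp = (lam : ℂ) • x.ofLp
  form : star x.ofLp ⬝ᵥ (C *ᵥ x.ofLp) = 0
  unit : star x.ofLp ⬝ᵥ x.ofLp = 1

/-- The set of all 2D-eigenvectors belonging to `(μ, lam)`. -/
def eigenvectorSet {n : ℕ} (A C : Matrix (Fin n) (Fin n) ℂ) (μ lam : ℝ) :
    Set (EuclideanSpace ℂ (Fin n)) :=
  {x | IsEigentriplet A C μ lam x}

/-- The `n × 2` block `[-C x, -x]`. -/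
def border {n : ℕ} (C : Matrix (Fin n) (Fin n) ℂ) (x : EuclideanSpace ℂ (Fin n)) :
    Matrix (Fin n) (Fin 2) ℂ :=
  Matrix.of fun i => ![-(C *ᵥ x.ofLp) i, -(x.ofLp i)]

/-- The `2 × n` block with rows `-xᴴ C` and `-xᴴ`. -/
def borderRows {n : ℕ} (C : Matrix (Fin n) (Fin n) ℂ) (x : EuclideanSpace ℂ (Fin n)) :
    Matrix (Fin 2) (Fin n) ℂ :=
  Matrix.of ![-(star x.ofLp ᵥ* C), -star x.ofLp]

/-- The Jacobian `J(μ, lam, x)`, with blocks `A - μ C - lam I`, `[-C x, -x]`, `[-xᴴ C; -xᴴ]`, `0`. -/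
def jacobian {n : ℕ} (A C : Matrix (Fin n) (Fin n) ℂ) (μ lam : ℝ)
    (x : EuclideanSpace ℂ (Fin n)) : Matrix (Fin n ⊕ Fin 2) (Fin n ⊕ Fin 2) ℂ :=
  Matrix.fromBlocks (A - (μ : ℂ) • C - (lam : ℂ) • 1) (border C x) (borderRows C x) 0

/-- The first `n` rows `[A - μ C - lam I, -C x, -x]` of the Jacobian. -/
def jacobianTop {n : ℕ} (A C : Matrix (Fin n) (Fin n) ℂ) (μ lam : ℝ)
    (x : EuclideanSpace ℂ (Fin n)) : Matrix (Fin n) (Fin n ⊕ Fin 2) ℂ :=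
  Matrix.fromCols (A - (μ : ℂ) • C - (lam : ℂ) • 1) (border C x)

/-- A nonsingular simple 2D-eigentriplet: the Jacobian is nonsingular and `lam` is an eigenvalue
of the Hermitian matrix `A - μ C` of multiplicity one. -/
structure IsNonsingularSimple {n : ℕ} (A C : Matrix (Fin n) (Fin n) ℂ) (μ lam : ℝ)
    (x : EuclideanSpace ℂ (Fin n)) : Prop where
  triplet : IsEigentriplet A C μ lam x
  nonsingular : IsUnit (jacobian A C μ lam x).det
  simple : Module.finrank ℂ
    (Module.End.eigenspace (Matrix.toLin' (A - (μ : ℂ) • C)) (lam : ℂ)) = 1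

/-- The 2D Rayleigh quotient `Vᴴ M V`. -/
def compress {n : ℕ} (M : Matrix (Fin n) (Fin n) ℂ) (V : Matrix (Fin n) (Fin 2) ℂ) :
    Matrix (Fin 2) (Fin 2) ℂ :=
  Vᴴ * M * V

/-- First (larger) diagonal entry of `Vᴴ C V`. -/
def c₁ {n : ℕ} (C : Matrix (Fin n) (Fin n) ℂ) (V : Matrix (Fin n) (Fin 2) ℂ) : ℝ :=
  (compress C V 0 0).re

/-- Second (smaller) diagonal entry of `Vᴴ C V`. -/
def c₂ {n : ℕ} (C : Matrix (Fin n) (Fin n) ℂ) (V : Matrix (Fin n) (Fin 2) ℂ) : ℝ :=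
  (compress C V 1 1).re

/-- `V` is an admissible projection matrix at `(μ, lam, x)`: its two columns are an orthonormal
basis of the column space of `Ṽ`, where `[Ṽ; R]` is a basis matrix of the null space of
`jacobianTop` (this column space is the image of the null space under the projection to the
first `n` coordinates), and `Vᴴ C V = diag(c₁, c₂)` with `c₁ ≥ c₂`. -/
structure IsProjectionMatrix {n : ℕ} (A C : Matrix (Fin n) (Fin n) ℂ) (μ lam : ℝ)
    (x : EuclideanSpace ℂ (Fin n)) (V : Matrix (Fin n) (Fin 2) ℂ) : Prop where
  orthonormal : Vᴴ * V = 1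
  span : LinearMap.range V.mulVecLin =
    (LinearMap.ker (jacobianTop A C μ lam x).mulVecLin).map (LinearMap.funLeft ℂ ℂ Sum.inl)
  diag : compress C V = Matrix.diagonal ![(c₁ C V : ℂ), (c₂ C V : ℂ)]
  order : c₂ C V ≤ c₁ C V

/-- The vector `z(α) = (√(-c₂/(c₁-c₂)), α √(c₁/(c₁-c₂)))`. -/
def ritzZ {n : ℕ} (C : Matrix (Fin n) (Fin n) ℂ) (V : Matrix (Fin n) (Fin 2) ℂ) (α : ℂ) :
    Fin 2 → ℂ :=
  ![((Real.sqrt (-c₂ C V / (c₁ C V - c₂ C V)) : ℝ) : ℂ),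
    α * ((Real.sqrt (c₁ C V / (c₁ C V - c₂ C V)) : ℝ) : ℂ)]

/-- `ν(α) = z(α)ᴴ C_k A_k z(α) / ‖C_k z(α)‖²`, with `A_k = Vᴴ A V` and `C_k = Vᴴ C V`. -/
def ritzNu {n : ℕ} (A C : Matrix (Fin n) (Fin n) ℂ) (V : Matrix (Fin n) (Fin 2) ℂ) (α : ℂ) : ℂ :=
  (star (ritzZ C V α) ⬝ᵥ ((compress C V * compress A V) *ᵥ ritzZ C V α)) /
    ((‖WithLp.toLp 2 (compress C V *ᵥ ritzZ C V α)‖ ^ 2 : ℝ) : ℂ)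

/-- `θ(α) = z(α)ᴴ A_k z(α)`. -/
def ritzTheta {n : ℕ} (A C : Matrix (Fin n) (Fin n) ℂ) (V : Matrix (Fin n) (Fin 2) ℂ) (α : ℂ) :
    ℂ :=
  star (ritzZ C V α) ⬝ᵥ (compress A V *ᵥ ritzZ C V α)

/-- The vector `V z(α)` in `ℂⁿ`. -/
def ritzVec {n : ℕ} (C : Matrix (Fin n) (Fin n) ℂ) (V : Matrix (Fin n) (Fin 2) ℂ) (α : ℂ) :
    EuclideanSpace ℂ (Fin n) :=
  WithLp.toLp 2 (V *ᵥ ritzZ C V α)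

/-- The `(1,2)` entry `a₁₂` of `A_k = Vᴴ A V`. -/
def a₁₂ {n : ℕ} (A : Matrix (Fin n) (Fin n) ℂ) (V : Matrix (Fin n) (Fin 2) ℂ) : ℂ :=
  compress A V 0 1

/-- The two parameters `α = ± |a₁₂| / a₁₂` of the 2D-Ritz triplets when `a₁₂ ≠ 0`. -/
def ritzAlphas {n : ℕ} (A : Matrix (Fin n) (Fin n) ℂ) (V : Matrix (Fin n) (Fin 2) ℂ) : Set ℂ :=
  {((‖a₁₂ A V‖ : ℝ) : ℂ) / a₁₂ A V, -(((‖a₁₂ A V‖ : ℝ) : ℂ) / a₁₂ A V)}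

/-- `|μ - ν(α)| + |lam - θ(α)|`. -/
def ritzGap {n : ℕ} (A C : Matrix (Fin n) (Fin n) ℂ) (V : Matrix (Fin n) (Fin 2) ℂ) (μ lam : ℝ)
    (α : ℂ) : ℝ :=
  ‖(μ : ℂ) - ritzNu A C V α‖ + ‖(lam : ℂ) - ritzTheta A C V α‖

/-- The update in the case `a₁₂ ≠ 0`: of the two 2D-Ritz triplets `(ν(α), θ(α), V z(α))`,
`α = ± |a₁₂| / a₁₂`, one with the smaller value of `|μ - ν(α)| + |lam - θ(α)|` is taken. -/
def IsGenericUpdate {n : ℕ} (A C : Matrix (Fin n) (Fin n) ℂ) (V : Matrix (Fin n) (Fin 2) ℂ)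
    (μ lam μ' lam' : ℝ) (x' : EuclideanSpace ℂ (Fin n)) : Prop :=
  a₁₂ A V ≠ 0 ∧ ∃ α ∈ ritzAlphas A V, (∀ β ∈ ritzAlphas A V,
      ritzGap A C V μ lam α ≤ ritzGap A C V μ lam β) ∧
    (μ' : ℂ) = ritzNu A C V α ∧ (lam' : ℂ) = ritzTheta A C V α ∧ x' = ritzVec C V α

/-- The update in the case `a₁₂ = 0`: `μ' = (a₁₁ - a₂₂)/(c₁ - c₂)`,
`lam' = (a₂₂ c₁ - a₁₁ c₂)/(c₁ - c₂)`, `x' = V z(1)`. -/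
def IsDegenerateUpdate {n : ℕ} (A C : Matrix (Fin n) (Fin n) ℂ) (V : Matrix (Fin n) (Fin 2) ℂ)
    (μ' lam' : ℝ) (x' : EuclideanSpace ℂ (Fin n)) : Prop :=
  a₁₂ A V = 0 ∧
    (μ' : ℂ) = (compress A V 0 0 - compress A V 1 1) / ((c₁ C V : ℂ) - (c₂ C V : ℂ)) ∧
    (lam' : ℂ) = (compress A V 1 1 * (c₁ C V : ℂ) - compress A V 0 0 * (c₂ C V : ℂ)) /
      ((c₁ C V : ℂ) - (c₂ C V : ℂ)) ∧
    x' = ritzVec C V 1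

/-- One step of the 2D Rayleigh quotient iteration from `(μ, lam, x)` to `(μ', lam', x')` that
uses the projection matrix `V`. The step is carried out when the Jacobian is nonsingular and
`C_k = Vᴴ C V` is indefinite, i.e. `c₁ > 0 > c₂`. -/
structure IsStep {n : ℕ} (A C : Matrix (Fin n) (Fin n) ℂ) (V : Matrix (Fin n) (Fin 2) ℂ)
    (μ lam : ℝ) (x : EuclideanSpace ℂ (Fin n)) (μ' lam' : ℝ) (x' : EuclideanSpace ℂ (Fin n)) :
    Prop where
  nonsingular : IsUnit (jacobian A C μ lam x).det
  proj : IsProjectionMatrix A C μ lam x V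
  c₁_pos : 0 < c₁ C V
  c₂_neg : c₂ C V < 0
  update : IsGenericUpdate A C V μ lam μ' lam' x' ∨ IsDegenerateUpdate A C V μ' lam' x'

/-- `max(|μ - μs|, |lam - lams|, dist(x, X))`, where `X` is the set of 2D-eigenvectors
of `(μs, lams)` and `dist` is the Euclidean distance. -/
def err {n : ℕ} (A C : Matrix (Fin n) (Fin n) ℂ) (μs lams μ lam : ℝ)
    (x : EuclideanSpace ℂ (Fin n)) : ℝ :=
  max (max |μ - μs| |lam - lams|) (Metric.infDist x (eigenvectorSet A C μs lams))

end TwoDEVP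

end

noncomputable section
namespace TwoDEVP
open ComplexConjugate
open scoped Matrix.Norms.L2Operator

variable {n : ℕ} {A C : Matrix (Fin n) (Fin n) ℂ}

/-! Write `B = A - μ_* C - λ_* I` and let `g` be the 2D-eigenvector nearest to `x_k`. The proof
shows that the plane spanned by `V_k` almost contains two particular vectors, and that a two-by-two
problem with such data has a well-conditioned solution.

The first vector is `g`. Since `B g = 0`, applying `A - μ_k C - λ_k I` to `g` gives `-(μ_k-μ_*) C g
- (λ_k-λ_*) g`. Replacing `g` by `x_k` on the right puts this in the span of `C x_k` and `x_k`, at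
the price of a residual that is a product of two errors. Inverting the Jacobian, whose inverse is
bounded near the solution (`exists_lift_bound`), shows that `g` is within `O(ε²)` of the plane
(`exists_near_projection`). The second vector `y` satisfies `B y = t C g` and `gᴴ C y = 1` with `t ≠
0` (`IsNonsingularSimple.exists_second_direction`); it is only within `O(ε)` of the plane, but it is
used only for nondegeneracy.

Let `p`, `q` be the coordinates in `V_k` of the vectors of the plane near `g` and `y`. Almost
isotropy of `p` together with `pᴴ C_k q ≈ 1` forces `C_k` to be uniformly indefinite
(`indefinite_of_isotropic_pair`). The moduli of `p` are then nearly those of `z(α)`, and the value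
`qᴴ (Vᴴ B V) q ≈ t` keeps `a₁₂` away from zero, so that the small residual of `p` fixes its relative
phase up to an error `O(ε²)` (`exists_ritz_approx`). This yields one Ritz triplet within `O(ε²)`,
while the other Ritz value is at a distance bounded below (`exists_ritz_pair`), hence the strict
selection.

The eigenvalue error is quartic because `θ - λ_*` is the quadratic form of `B` at the Ritz vector,
and `B g = 0` turns it into the form at the vector error, which is `O(ε²)` (`exists_nearer_ritz`).
-/

lemma norm_dotProduct_mulVec_le (M : Matrix (Fin n) (Fin n) ℂ) (u v : Fin n → ℂ) :
    ‖star u ⬝ᵥ (M *ᵥ v)‖ ≤ ‖M‖ * ‖WithLp.toLp 2 u‖ * ‖WithLp.toLp 2 v‖ := by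
  have h : star u ⬝ᵥ (M *ᵥ v) = inner ℂ (WithLp.toLp 2 u) (WithLp.toLp 2 (M *ᵥ v)) := by
    rw [EuclideanSpace.inner_toLp_toLp, dotProduct_comm]
  rw [h]
  refine (norm_inner_le_norm _ _).trans ?_
  have : ‖WithLp.toLp 2 (M *ᵥ v)‖ ≤ ‖M‖ * ‖WithLp.toLp 2 v‖ :=
    Matrix.l2_opNorm_mulVec M (WithLp.toLp 2 v)
  calc _ ≤ ‖WithLp.toLp 2 u‖ * (‖M‖ * ‖WithLp.toLp 2 v‖) := by gcongr
    _ = _ := by ring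

/-! ### The Jacobian: block action, change of phase, uniform invertibility. -/

lemma jacobian_mulVec_inl (μ lam : ℝ) (x : EuclideanSpace ℂ (Fin n)) (u : Fin n ⊕ Fin 2 → ℂ)
    (i : Fin n) :
    (jacobian A C μ lam x *ᵥ u) (Sum.inl i) =
      ((A - (μ : ℂ) • C - (lam : ℂ) • 1) *ᵥ (u ∘ Sum.inl)
        - u (Sum.inr 0) • (C *ᵥ x.ofLp) - u (Sum.inr 1) • x.ofLp : Fin n → ℂ) i := by
  rw [jacobian, fromBlocks_mulVec]
  simp [border, mulVec, dotProduct, Fin.sum_univ_two]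
  ring

lemma jacobian_mulVec_inr_zero (μ lam : ℝ) (x : EuclideanSpace ℂ (Fin n))
    (u : Fin n ⊕ Fin 2 → ℂ) :
    (jacobian A C μ lam x *ᵥ u) (Sum.inr 0) = -(star x.ofLp ⬝ᵥ (C *ᵥ (u ∘ Sum.inl))) := by
  rw [jacobian, fromBlocks_mulVec, dotProduct_mulVec]
  simp [borderRows, dotProduct]

lemma jacobian_mulVec_inr_one (μ lam : ℝ) (x : EuclideanSpace ℂ (Fin n))
    (u : Fin n ⊕ Fin 2 → ℂ) :
    (jacobian A C μ lam x *ᵥ u) (Sum.inr 1) = -(star x.ofLp ⬝ᵥ (u ∘ Sum.inl)) := by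
  rw [jacobian, fromBlocks_mulVec]
  simp [borderRows, dotProduct]

lemma mem_projection_iff (μ lam : ℝ) (x : EuclideanSpace ℂ (Fin n)) (v : Fin n → ℂ) :
    v ∈ (LinearMap.ker (jacobianTop A C μ lam x).mulVecLin).map (LinearMap.funLeft ℂ ℂ Sum.inl) ↔
      ∃ a b : ℂ, (A - (μ : ℂ) • C - (lam : ℂ) • 1) *ᵥ v - a • (C *ᵥ x.ofLp) - b • x.ofLp = 0 := by
  have key (u : Fin n ⊕ Fin 2 → ℂ) : jacobianTop A C μ lam x *ᵥ u =
      (A - (μ : ℂ) • C - (lam : ℂ) • 1) *ᵥ (u ∘ Sum.inl)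
        - u (Sum.inr 0) • (C *ᵥ x.ofLp) - u (Sum.inr 1) • x.ofLp := by
    rw [jacobianTop, fromCols_mulVec]
    funext i
    simp [border, mulVec, dotProduct, Fin.sum_univ_two]
    ring
  simp only [Submodule.mem_map, LinearMap.mem_ker, mulVecLin_apply, key]
  constructor
  · rintro ⟨u, hu, rfl⟩
    exact ⟨_, _, hu⟩
  · rintro ⟨a, b, h⟩
    refine ⟨Sum.elim v ![a, b], ?_, ?_⟩
    · simpa using h
    · funext i; simp [LinearMap.funLeft]

/-- Only the border depends on the vector, so a change of phase multiplies the Jacobian on both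
sides by block diagonal matrices. Invertibility near one 2D-eigenvector thus carries over to all its
unit multiples. -/
lemma jacobian_smul (μ lam : ℝ) (x : EuclideanSpace ℂ (Fin n)) (γ : ℂ) :
    jacobian A C μ lam (γ • x) =
      fromBlocks 1 0 0 ((star γ) • (1 : Matrix (Fin 2) (Fin 2) ℂ)) * jacobian A C μ lam x *
        fromBlocks 1 0 0 (γ • (1 : Matrix (Fin 2) (Fin 2) ℂ)) := by
  have h1 : border C (γ • x) = γ • border C x := by
    ext i j; fin_cases j <;> simp [border, mulVec_smul]
  have h2 : borderRows C (γ • x) = star γ • borderRows C x := by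
    ext i j; fin_cases i <;> simp [borderRows, smul_vecMul]
  simp [jacobian, fromBlocks_multiply, h1, h2]

lemma isUnit_det_jacobian_smul {μ lam : ℝ} {x : EuclideanSpace ℂ (Fin n)} {γ : ℂ} (hγ : ‖γ‖ = 1)
    (h : IsUnit (jacobian A C μ lam x).det) : IsUnit (jacobian A C μ lam (γ • x)).det := by
  have hγ0 : γ ≠ 0 := by rintro rfl; simp at hγ
  rw [jacobian_smul μ lam x γ, det_mul, det_mul]
  rw [isUnit_iff_ne_zero] at h ⊢
  simp [h, hγ0]

lemma continuous_jacobian :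
    Continuous fun p : ℝ × ℝ × EuclideanSpace ℂ (Fin n) => jacobian A C p.1 p.2.1 p.2.2 := by
  unfold jacobian
  refine Continuous.matrix_fromBlocks ?_ ?_ ?_ continuous_const
  · fun_prop
  · refine continuous_matrix fun i j => ?_
    fin_cases j <;> simp [border, mulVec, dotProduct] <;> fun_prop
  · refine continuous_matrix fun i j => ?_
    fin_cases i <;> simp [borderRows, vecMul, dotProduct] <;> fun_prop

/-- Inversion is continuous at an invertible matrix, so `‖J⁻¹‖` stays below its value at the
solution plus one on a neighbourhood. Solving `J u = (r, 0)` and keeping the first block of `u`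
gives `e`; no bound on `a` and `b` is needed. -/
lemma exists_lift_bound {μs lams : ℝ} {xs : EuclideanSpace ℂ (Fin n)}
    (hJ : IsUnit (jacobian A C μs lams xs).det) :
    ∃ M > 0, ∃ η > 0, ∀ (μ lam : ℝ) (x : EuclideanSpace ℂ (Fin n)),
      |μ - μs| < η → |lam - lams| < η → ‖x - xs‖ < η →
      IsUnit (jacobian A C μ lam x).det ∧ ∀ r : Fin n → ℂ, ∃ (e : Fin n → ℂ) (a b : ℂ),
        (A - (μ : ℂ) • C - (lam : ℂ) • 1) *ᵥ e - a • (C *ᵥ x.ofLp) - b • x.ofLp = r ∧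
        ‖WithLp.toLp 2 e‖ ≤ M * ‖WithLp.toLp 2 r‖ := by
  set f : ℝ × ℝ × EuclideanSpace ℂ (Fin n) → Matrix (Fin n ⊕ Fin 2) (Fin n ⊕ Fin 2) ℂ :=
    fun p => jacobian A C p.1 p.2.1 p.2.2 with hf
  have hfc : Continuous f := continuous_jacobian
  have hinv : ContinuousAt (fun p => ‖(f p)⁻¹‖) (μs, lams, xs) := by
    obtain ⟨u, hu⟩ := (Matrix.isUnit_iff_isUnit_det _).2 hJ
    have h0 : ContinuousAt Ring.inverse (f (μs, lams, xs)) := by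
      have : f (μs, lams, xs) = u := hu.symm
      rw [this]
      exact NormedRing.inverse_continuousAt u
    have h1 := ContinuousAt.comp (x := (μs, lams, xs)) h0 hfc.continuousAt
    have h2 : (fun p => ‖(f p)⁻¹‖) = fun p => ‖Ring.inverse (f p)‖ := by
      funext p; rw [nonsing_inv_eq_ringInverse]
    rw [h2]
    exact h1.norm
  have hb := hinv.eventually_lt (continuousAt_const (y := ‖(f (μs, lams, xs))⁻¹‖ + 1)) (by simp)
  have hd : ∀ᶠ p in nhds (μs, lams, xs), (f p).det ≠ 0 :=
    (hfc.matrix_det.continuousAt).eventually_ne (isUnit_iff_ne_zero.1 hJ)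
  obtain ⟨η, hη, hall⟩ := Metric.eventually_nhds_iff.1 (hb.and hd)
  refine ⟨‖(f (μs, lams, xs))⁻¹‖ + 1, by positivity, η, hη, fun μ lam x h1 h2 h3 => ?_⟩
  obtain ⟨hM, hdet⟩ := hall (y := (μ, lam, x)) (by
    rw [Prod.dist_eq, Prod.dist_eq, Real.dist_eq, Real.dist_eq, dist_eq_norm]
    exact max_lt h1 (max_lt h2 h3))
  have hunit : IsUnit (jacobian A C μ lam x).det := isUnit_iff_ne_zero.2 hdet
  refine ⟨hunit, fun r => ?_⟩
  set R : Fin n ⊕ Fin 2 → ℂ := Sum.elim r 0 with hR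
  set u := (jacobian A C μ lam x)⁻¹ *ᵥ R with hu
  have hJu : jacobian A C μ lam x *ᵥ u = R := by
    rw [hu, mulVec_mulVec, mul_nonsing_inv _ hunit, one_mulVec]
  refine ⟨u ∘ Sum.inl, u (Sum.inr 0), u (Sum.inr 1), ?_, ?_⟩
  · funext i
    rw [← jacobian_mulVec_inl, hJu, hR, Sum.elim_inl]
  · have e1 : ‖WithLp.toLp 2 (u ∘ Sum.inl)‖ ≤ ‖WithLp.toLp 2 u‖ := by
      rw [EuclideanSpace.norm_eq, EuclideanSpace.norm_eq]
      refine Real.sqrt_le_sqrt ?_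
      rw [Fintype.sum_sum_type]
      simp only [Function.comp]
      have : 0 ≤ ∑ a₂ : Fin 2, ‖u (Sum.inr a₂)‖ ^ 2 := by positivity
      simpa using this
    have e2 : ‖WithLp.toLp 2 R‖ = ‖WithLp.toLp 2 r‖ := by
      rw [EuclideanSpace.norm_eq, EuclideanSpace.norm_eq, Fintype.sum_sum_type]
      simp [hR]
    have e3 := Matrix.l2_opNorm_mulVec (jacobian A C μ lam x)⁻¹ (WithLp.toLp 2 R)
    rw [e2] at e3
    refine (e1.trans e3).trans ?_
    gcongr

/-! ### 2D-eigentriplets and the companion direction `y`. -/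

lemma IsEigentriplet.smul {μ lam : ℝ} {x : EuclideanSpace ℂ (Fin n)}
    (h : IsEigentriplet A C μ lam x) {γ : ℂ} (hγ : ‖γ‖ = 1) :
    IsEigentriplet A C μ lam (γ • x) := by
  have h1 : star γ * γ = 1 := by
    rw [Complex.star_def, ← Complex.normSq_eq_conj_mul_self, Complex.normSq_eq_norm_sq, hγ]; simp
  refine ⟨?_, ?_, ?_⟩
  · simp only [WithLp.ofLp_smul, mulVec_smul]
    rw [h.eig, smul_comm]
  · simp [mulVec_smul, h.form]
  · simp only [WithLp.ofLp_smul, star_smul, smul_dotProduct, dotProduct_smul, h.unit, smul_eq_mul,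
      mul_one]
    rw [mul_comm, h1]

lemma IsEigentriplet.norm_eq {μ lam : ℝ} {x : EuclideanSpace ℂ (Fin n)}
    (h : IsEigentriplet A C μ lam x) : ‖x‖ = 1 := by
  have h1 := h.unit
  rw [dotProduct_comm, ← EuclideanSpace.inner_eq_star_dotProduct, inner_self_eq_norm_sq_to_K] at h1
  have h2 : ‖x‖ ^ 2 = 1 := by
    apply Complex.ofReal_injective
    simpa using h1
  nlinarith [norm_nonneg x]

lemma IsEigentriplet.sub_mulVec {μ lam : ℝ} {x : EuclideanSpace ℂ (Fin n)}
    (h : IsEigentriplet A C μ lam x) :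
    (A - (μ : ℂ) • C - (lam : ℂ) • 1) *ᵥ x.ofLp = 0 := by
  rw [Matrix.sub_mulVec, h.eig, smul_mulVec, one_mulVec, sub_self]

lemma IsNonsingularSimple.exists_smul_eq {μ lam : ℝ} {x : EuclideanSpace ℂ (Fin n)}
    (h : IsNonsingularSimple A C μ lam x) {v : Fin n → ℂ}
    (hv : (A - (μ : ℂ) • C - (lam : ℂ) • 1) *ᵥ v = 0) : ∃ c : ℂ, v = c • x.ofLp := by
  have hmem (w : Fin n → ℂ) (hw : (A - (μ : ℂ) • C - (lam : ℂ) • 1) *ᵥ w = 0) :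
      w ∈ Module.End.eigenspace (Matrix.toLin' (A - (μ : ℂ) • C)) (lam : ℂ) := by
    rw [Module.End.mem_eigenspace_iff, toLin'_apply]
    rwa [Matrix.sub_mulVec, smul_mulVec, one_mulVec, sub_eq_zero] at hw
  have hx0 : x.ofLp ≠ 0 := by
    intro h0
    have := h.triplet.unit
    simp [h0] at this
  obtain ⟨c, hc⟩ := exists_smul_eq_of_finrank_eq_one h.simple
    (x := ⟨x.ofLp, hmem _ h.triplet.sub_mulVec⟩) (by simpa [Subtype.ext_iff] using hx0) ⟨v, hmem v hv⟩
  exact ⟨c, by simpa [Subtype.ext_iff] using hc.symm⟩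

lemma IsNonsingularSimple.exists_rotation {μ lam : ℝ} {x g : EuclideanSpace ℂ (Fin n)}
    (h : IsNonsingularSimple A C μ lam x) (hg : IsEigentriplet A C μ lam g) :
    ∃ γ : ℂ, ‖γ‖ = 1 ∧ g = γ • x := by
  obtain ⟨c, hc⟩ := h.exists_smul_eq hg.sub_mulVec
  have hgc : g = c • x := by
    apply (WithLp.ofLp_injective 2); simpa using hc
  refine ⟨c, ?_, hgc⟩
  have := hg.norm_eq
  rwa [hgc, norm_smul, h.triplet.norm_eq, mul_one] at this

/-- Closedness makes the distance to the set attained, so that a nearest 2D-eigenvector can be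
chosen. -/
lemma isClosed_eigenvectorSet (μ lam : ℝ) : IsClosed (eigenvectorSet A C μ lam) := by
  have : eigenvectorSet A C μ lam =
      {x | (A - (μ : ℂ) • C) *ᵥ x.ofLp = (lam : ℂ) • x.ofLp} ∩
      ({x | star x.ofLp ⬝ᵥ (C *ᵥ x.ofLp) = 0} ∩ {x | star x.ofLp ⬝ᵥ x.ofLp = 1}) := by
    ext x
    exact ⟨fun h => ⟨h.eig, h.form, h.unit⟩, fun h => ⟨h.1, h.2.1, h.2.2⟩⟩
  rw [this]
  refine IsClosed.inter ?_ (IsClosed.inter ?_ ?_)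
  · exact isClosed_eq (by fun_prop) (by fun_prop)
  · refine isClosed_eq ?_ continuous_const
    exact Continuous.dotProduct (by fun_prop) (by fun_prop)
  · refine isClosed_eq ?_ continuous_const
    exact Continuous.dotProduct (by fun_prop) (by fun_prop)

lemma isHermitian_pencil (hA : A.IsHermitian) (hC : C.IsHermitian) (μ lam : ℝ) :
    (A - (μ : ℂ) • C - (lam : ℂ) • 1).IsHermitian := by
  simp [IsHermitian, hA.eq, hC.eq, conjTranspose_sub, conjTranspose_smul]

/-- The vector `y` is the first block of `J⁻¹ (0; -1, 0)`, which also makes it orthogonal to `x`. If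
`t` vanished, `y` would lie in the kernel of `A - μ C - lam I`, hence be a multiple of `x` by
simplicity, hence zero by orthogonality, against `xᴴ C y = 1`. -/
lemma IsNonsingularSimple.exists_second_direction {μ lam : ℝ} {x : EuclideanSpace ℂ (Fin n)}
    (hA : A.IsHermitian) (hC : C.IsHermitian) (h : IsNonsingularSimple A C μ lam x) :
    ∃ (y : Fin n → ℂ) (t : ℂ), t ≠ 0 ∧ star x.ofLp ⬝ᵥ (C *ᵥ y) = 1 ∧
      (A - (μ : ℂ) • C - (lam : ℂ) • 1) *ᵥ y = t • (C *ᵥ x.ofLp) ∧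
      star y ⬝ᵥ ((A - (μ : ℂ) • C - (lam : ℂ) • 1) *ᵥ y) = t := by
  set B := A - (μ : ℂ) • C - (lam : ℂ) • 1 with hB
  have hBh : B.IsHermitian := isHermitian_pencil hA hC μ lam
  have herm {M : Matrix (Fin n) (Fin n) ℂ} (hM : M.IsHermitian) (u v : Fin n → ℂ) :
      star u ⬝ᵥ (M *ᵥ v) = star (star v ⬝ᵥ (M *ᵥ u)) := by
    rw [star_dotProduct, star_mulVec, hM.eq, ← dotProduct_mulVec]
  set R : Fin n ⊕ Fin 2 → ℂ := Sum.elim 0 ![-1, 0] with hR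
  set u := (jacobian A C μ lam x)⁻¹ *ᵥ R with hu
  have hJu : jacobian A C μ lam x *ᵥ u = R := by
    rw [hu, mulVec_mulVec, mul_nonsing_inv _ h.nonsingular, one_mulVec]
  have h1 : B *ᵥ (u ∘ Sum.inl) - u (Sum.inr 0) • (C *ᵥ x.ofLp) - u (Sum.inr 1) • x.ofLp = 0 := by
    funext i
    rw [← jacobian_mulVec_inl, hJu]
    simp [hR]
  have h2 : star x.ofLp ⬝ᵥ (C *ᵥ (u ∘ Sum.inl)) = 1 := by
    have := jacobian_mulVec_inr_zero (A := A) (C := C) μ lam x u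
    rw [hJu] at this
    simpa [hR] using this.symm
  have h3 : star x.ofLp ⬝ᵥ (u ∘ Sum.inl) = 0 := by
    have := jacobian_mulVec_inr_one (A := A) (C := C) μ lam x u
    rw [hJu] at this
    simpa [hR] using this.symm
  -- Pairing the first block equation with `x` kills the pencil term (`B` is Hermitian and `B x =
  -- 0`) and the `C x` term (isotropy), leaving the coefficient of `x`.
  have h4 : u (Sum.inr 1) = 0 := by
    have := congrArg (fun v => star x.ofLp ⬝ᵥ v) h1
    simp only [dotProduct_sub, dotProduct_smul, h.triplet.form, h.triplet.unit] at this
    rw [herm hBh, h.triplet.sub_mulVec] at this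
    simpa using this
  rw [h4, zero_smul, sub_zero, sub_eq_zero] at h1
  refine ⟨u ∘ Sum.inl, u (Sum.inr 0), ?_, h2, h1, ?_⟩
  · intro h0
    rw [h0, zero_smul] at h1
    obtain ⟨c, hc⟩ := h.exists_smul_eq h1
    rw [hc, dotProduct_smul, h.triplet.unit, smul_eq_mul, mul_one] at h3
    rw [hc, h3] at h2
    simp at h2
  · rw [h1, dotProduct_smul, herm hC, h2]; simp

/-! ### Existence of an admissible projection matrix. -/

/-- The top rows of an invertible matrix are surjective, so their kernel has dimension `(n + 2) -
n`. Dropping the last two coordinates is injective on it: the bottom rows of `J` see only the first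
block, so a kernel vector with zero first block is killed by all of `J`. -/
lemma finrank_projection {μ lam : ℝ} {x : EuclideanSpace ℂ (Fin n)}
    (hJ : IsUnit (jacobian A C μ lam x).det) :
    Module.finrank ℂ ((LinearMap.ker (jacobianTop A C μ lam x).mulVecLin).map
      (LinearMap.funLeft ℂ ℂ (Sum.inl : Fin n → Fin n ⊕ Fin 2))) = 2 := by
  have hinj : Function.Injective (jacobian A C μ lam x).mulVec :=
    mulVec_injective_iff_isUnit.2 ((Matrix.isUnit_iff_isUnit_det _).2 hJ)
  have htop (u : Fin n ⊕ Fin 2 → ℂ) (i : Fin n) :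
      (jacobianTop A C μ lam x *ᵥ u) i = (jacobian A C μ lam x *ᵥ u) (Sum.inl i) := by
    rw [jacobian, jacobianTop, fromBlocks_mulVec, fromCols_mulVec]; simp
  have hsurj : Function.Surjective (jacobianTop A C μ lam x).mulVecLin := by
    intro r
    refine ⟨(jacobian A C μ lam x)⁻¹ *ᵥ Sum.elim r 0, ?_⟩
    funext i
    rw [mulVecLin_apply, htop, mulVec_mulVec, mul_nonsing_inv _ hJ, one_mulVec, Sum.elim_inl]
  have hrn := LinearMap.finrank_range_add_finrank_ker (jacobianTop A C μ lam x).mulVecLin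
  rw [LinearMap.range_eq_top.2 hsurj, finrank_top] at hrn
  simp only [Module.finrank_fintype_fun_eq_card, Fintype.card_sum, Fintype.card_fin] at hrn
  have hk : Module.finrank ℂ (LinearMap.ker (jacobianTop A C μ lam x).mulVecLin) = 2 := by omega
  set φ := (LinearMap.funLeft ℂ ℂ (Sum.inl : Fin n → Fin n ⊕ Fin 2)).domRestrict
    (LinearMap.ker (jacobianTop A C μ lam x).mulVecLin) with hφ
  have hφi : Function.Injective φ := by
    rw [injective_iff_map_eq_zero]
    rintro ⟨u, hu⟩ h0
    have h0' : u ∘ Sum.inl = 0 := h0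
    rw [LinearMap.mem_ker, mulVecLin_apply] at hu
    have : jacobian A C μ lam x *ᵥ u = 0 := by
      funext i
      rcases i with i | i
      · rw [← htop, hu]; rfl
      · fin_cases i
        · simpa [h0'] using jacobian_mulVec_inr_zero (A := A) (C := C) μ lam x u
        · simpa [h0'] using jacobian_mulVec_inr_one (A := A) (C := C) μ lam x u
    have : u = 0 := hinj (by simpa using this)
    simpa using this
  have := LinearMap.finrank_range_of_inj hφi
  rwa [hk, hφ, LinearMap.range_domRestrict] at this

lemma exists_orthonormal_columns (W : Submodule ℂ (Fin n → ℂ)) (hW : Module.finrank ℂ W = 2) :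
    ∃ V : Matrix (Fin n) (Fin 2) ℂ, Vᴴ * V = 1 ∧ LinearMap.range V.mulVecLin = W := by
  set e := (WithLp.linearEquiv 2 ℂ (Fin n → ℂ)).symm
  set W' : Submodule ℂ (EuclideanSpace ℂ (Fin n)) := W.map e.toLinearMap with hW'
  have hf : Module.finrank ℂ W' = 2 := by
    rw [hW', LinearEquiv.finrank_map_eq, hW]
  let b := (stdOrthonormalBasis ℂ W').reindex (finCongr hf)
  refine ⟨of fun i j => (b j : EuclideanSpace ℂ (Fin n)).ofLp i, ?_, ?_⟩
  · ext i j
    have h := orthonormal_iff_ite.1 b.orthonormal i j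
    rw [Submodule.coe_inner, EuclideanSpace.inner_eq_star_dotProduct] at h
    rw [one_apply, ← h]
    simp [mul_apply, dotProduct, mul_comm]
  · rw [range_mulVecLin]
    have h1 : Submodule.span ℂ (Set.range fun j => (b j : EuclideanSpace ℂ (Fin n))) = W' := by
      have := b.toBasis.span_eq
      have h2 := congrArg (Submodule.map W'.subtype) this
      rw [Submodule.map_span, Submodule.map_top, Submodule.range_subtype, ← Set.range_comp] at h2
      refine Eq.trans ?_ h2
      congr 2
    have h3 := congrArg (Submodule.map e.symm.toLinearMap) h1
    rw [Submodule.map_span, ← Set.range_comp] at h3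
    refine (Eq.trans ?_ h3).trans ?_
    · rfl
    · rw [hW', ← Submodule.map_comp]
      simp

/-- Any orthonormal basis of the plane may be rotated by a unitary diagonalising `Vᴴ C V`, with its
columns permuted to order the eigenvalues. -/
lemma exists_isProjectionMatrix (hC : C.IsHermitian) {μ lam : ℝ} {x : EuclideanSpace ℂ (Fin n)}
    (hJ : IsUnit (jacobian A C μ lam x).det) : ∃ V, IsProjectionMatrix A C μ lam x V := by
  obtain ⟨V, hV, hr⟩ := exists_orthonormal_columns _ (finrank_projection hJ)
  have hM : (Vᴴ * C * V).IsHermitian := isHermitian_conjTranspose_mul_mul V hC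
  set U : Matrix (Fin 2) (Fin 2) ℂ := (hM.eigenvectorUnitary : Matrix (Fin 2) (Fin 2) ℂ) with hU
  obtain ⟨σ, hσ⟩ : ∃ σ : Equiv.Perm (Fin 2), hM.eigenvalues (σ 1) ≤ hM.eigenvalues (σ 0) := by
    rcases le_total (hM.eigenvalues 1) (hM.eigenvalues 0) with h | h
    · exact ⟨1, h⟩
    · exact ⟨Equiv.swap 0 1, by simpa using h⟩
  have hUU : Uᴴ * U = 1 := by
    rw [← star_eq_conjTranspose]; exact Unitary.coe_star_mul_self hM.eigenvectorUnitary
  have hUU' : U * Uᴴ = 1 := mul_eq_one_comm.1 hUU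
  set P := U.submatrix id σ with hP
  have hPP : Pᴴ * P = 1 := by
    have : Pᴴ * P = (Uᴴ * U).submatrix σ σ := rfl
    rw [this, hUU, submatrix_one_equiv]
  have hPP' : P * Pᴴ = 1 := mul_eq_one_comm.1 hPP
  have hD : Uᴴ * (Vᴴ * C * V) * U = diagonal fun i => (hM.eigenvalues i : ℂ) := by
    have := hM.conjStarAlgAut_star_eigenvectorUnitary
    rw [Unitary.conjStarAlgAut_star_apply] at this
    exact this
  have hc : compress C (V * P) = diagonal fun i => (hM.eigenvalues (σ i) : ℂ) := by
    have : compress C (V * P) = (Uᴴ * (Vᴴ * C * V) * U).submatrix σ σ := by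
      have h2 : compress C (V * P) = Pᴴ * (Vᴴ * C * V) * P := by
        simp only [compress, conjTranspose_mul, Matrix.mul_assoc]
      rw [h2]
      rfl
    rw [this, hD]
    ext i j
    simp [diagonal_apply]
  refine ⟨V * P, ?_, ?_, ?_, ?_⟩
  · rw [conjTranspose_mul, Matrix.mul_assoc, ← Matrix.mul_assoc Vᴴ, hV, Matrix.one_mul, hPP]
  · rw [← hr, mulVecLin_mul, LinearMap.range_comp_of_range_eq_top]
    rw [LinearMap.range_eq_top]
    intro v
    exact ⟨Pᴴ *ᵥ v, by
      rw [mulVecLin_apply, mulVec_mulVec, hPP', one_mulVec]⟩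
  · rw [c₁, c₂, hc]
    ext i j
    fin_cases i <;> fin_cases j <;> simp
  · rw [c₁, c₂, hc]
    simpa using hσ

/-! ### Quantitative estimates for the two-by-two problem. -/

/-- The Gram determinant of `p`, `q` for the form `diag(c1, c2)` equals `c1 c2 |det(p, q)|²`. Here
it is at most `1/8 - 1/4 < 0`, and `|det(p, q)|² ≤ 4K²`, so `-c1 c2 ≥ 1/(32K²)`. Dividing by the
upper bound `K` for either factor bounds the other from below. -/
lemma indefinite_of_isotropic_pair {K δ c1 c2 : ℝ} {p1 p2 q1 q2 : ℂ} (hK : 1 ≤ K)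
    (hδ1 : 16 * K ^ 4 * δ ≤ 1) (h12 : c2 ≤ c1) (hc1 : |c1| ≤ K) (hc2 : |c2| ≤ K)
    (hq1 : ‖q1‖ ≤ K) (hq2 : ‖q2‖ ≤ K) (hpp : |c1 * ‖p1‖ ^ 2 + c2 * ‖p2‖ ^ 2| ≤ K * δ)
    (hp : ‖p1‖ ^ 2 + ‖p2‖ ^ 2 ≤ 2) (hpq : 1 / 2 ≤ ‖c1 * conj p1 * q1 + c2 * conj p2 * q2‖) :
    1 / (32 * K ^ 3) ≤ c1 ∧ c2 ≤ -(1 / (32 * K ^ 3)) := by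
  have hK0 : 0 < K := by linarith
  have hid : c1 * c2 * ‖p1 * q2 - p2 * q1‖ ^ 2 =
      (c1 * ‖p1‖ ^ 2 + c2 * ‖p2‖ ^ 2) * (c1 * ‖q1‖ ^ 2 + c2 * ‖q2‖ ^ 2) -
        ‖c1 * conj p1 * q1 + c2 * conj p2 * q2‖ ^ 2 := by
    simp only [Complex.sq_norm, Complex.normSq_apply]
    simp
    ring
  have hq : |c1 * ‖q1‖ ^ 2 + c2 * ‖q2‖ ^ 2| ≤ 2 * K ^ 3 := by
    calc _ ≤ |c1 * ‖q1‖ ^ 2| + |c2 * ‖q2‖ ^ 2| := abs_add_le _ _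
      _ = |c1| * ‖q1‖ ^ 2 + |c2| * ‖q2‖ ^ 2 := by simp [abs_mul]
      _ ≤ K * K ^ 2 + K * K ^ 2 := by gcongr
      _ = _ := by ring
  have hX : ‖p1 * q2 - p2 * q1‖ ^ 2 ≤ 4 * K ^ 2 := by
    have h1 : ‖p1 * q2 - p2 * q1‖ ≤ ‖p1‖ * K + ‖p2‖ * K := by
      refine (norm_sub_le _ _).trans ?_
      rw [norm_mul, norm_mul]
      gcongr
    calc _ ≤ (‖p1‖ * K + ‖p2‖ * K) ^ 2 := by gcongr
      _ ≤ 2 * (‖p1‖ ^ 2 + ‖p2‖ ^ 2) * K ^ 2 := by nlinarith [mul_nonneg (sq_nonneg (‖p1‖ - ‖p2‖)) (sq_nonneg K)]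
      _ ≤ 2 * 2 * K ^ 2 := by gcongr
      _ = _ := by ring
  have hprod : c1 * c2 * ‖p1 * q2 - p2 * q1‖ ^ 2 ≤ -(1 / 8) := by
    have h1 : (c1 * ‖p1‖ ^ 2 + c2 * ‖p2‖ ^ 2) * (c1 * ‖q1‖ ^ 2 + c2 * ‖q2‖ ^ 2) ≤
        (K * δ) * (2 * K ^ 3) := by
      refine (le_abs_self _).trans ?_
      rw [abs_mul]
      gcongr
      exact (abs_nonneg _).trans hpp
    have h2 : (1 / 2 : ℝ) ^ 2 ≤ ‖c1 * conj p1 * q1 + c2 * conj p2 * q2‖ ^ 2 := by gcongr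
    rw [hid]
    nlinarith
  have hneg : c1 * c2 < 0 := by
    by_contra h
    push Not at h
    nlinarith [mul_nonneg h (sq_nonneg ‖p1 * q2 - p2 * q1‖)]
  have hcc : 1 / 8 ≤ -(c1 * c2) * (4 * K ^ 2) := by
    calc (1 / 8 : ℝ) ≤ -(c1 * c2) * ‖p1 * q2 - p2 * q1‖ ^ 2 := by linarith
      _ ≤ _ := by gcongr; linarith
  have hc1p : 0 < c1 := by
    by_contra h
    push Not at h
    nlinarith [mul_nonneg_of_nonpos_of_nonpos h (h12.trans h)]
  have hc2n : c2 < 0 := by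
    by_contra h
    push Not at h
    nlinarith [mul_nonneg hc1p.le h]
  rw [abs_of_pos hc1p] at hc1
  rw [abs_of_neg hc2n] at hc2
  constructor
  · rw [div_le_iff₀ (by positivity)]
    have : -c2 * c1 ≤ K * c1 := by gcongr
    nlinarith [mul_le_mul_of_nonneg_right this (sq_nonneg K)]
  · rw [le_neg, div_le_iff₀ (by positivity)]
    have : c1 * -c2 ≤ K * -c2 := by gcongr; linarith
    nlinarith [mul_le_mul_of_nonneg_right this (sq_nonneg K)]

/-- After removing the phase `γ` of `p1`, the term `h p1` is real. A small residual `h p1 + a p2`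
therefore makes `a p2 / γ` nearly real, which determines the phase of `p2` up to sign. -/
lemma exists_ritz_direction {a p1 p2 : ℂ} (h t : ℝ) (ha : a ≠ 0) (hp1 : p1 ≠ 0) :
    ∃ α : ℂ, (α = (‖a‖ : ℂ) / a ∨ α = -((‖a‖ : ℂ) / a)) ∧ ∃ γ : ℂ, ‖γ‖ = 1 ∧ p1 = γ * ‖p1‖ ∧
      ‖p2 - γ * (α * t)‖ ≤ |‖p2‖ - t| + 2 * (‖h * p1 + a * p2‖ / ‖a‖) := by
  have ha' : (‖a‖ : ℂ) ≠ 0 := by simpa using ha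
  have hp' : (‖p1‖ : ℂ) ≠ 0 := by simpa using hp1
  set γ := p1 / ‖p1‖ with hγ
  have hγn : ‖γ‖ = 1 := by simp [hγ, hp1]
  have hγ0 : γ ≠ 0 := by simp [hγ, hp1]
  have hp1γ : p1 = γ * ‖p1‖ := by rw [hγ]; field_simp
  -- In this normalisation `|m| = |p2|`, the residual controls `Im m`, and the sign of `Re m`
  -- chooses `α`. The factor 2 in the bound arises because `Im m` enters once directly and once
  -- through `|m| - |Re m|`.
  set m := a * (p2 / γ) / ‖a‖ with hm
  have hp2 : p2 = γ * ((‖a‖ : ℂ) / a * m) := by rw [hm]; field_simp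
  have hmn : ‖m‖ = ‖p2‖ := by
    rw [hm]; simp [hγn]; field_simp [norm_ne_zero_iff.2 ha]
  have him : |m.im| ≤ ‖h * p1 + a * p2‖ / ‖a‖ := by
    have h1 : m.im = ((h * p1 + a * p2) / γ / ‖a‖).im := by
      have : (h * p1 + a * p2) / γ / ‖a‖ = ((h * ‖p1‖ / ‖a‖ : ℝ) : ℂ) + m := by
        rw [hm]; nth_rewrite 1 [hp1γ]; push_cast; field_simp
      rw [this, Complex.add_im, Complex.ofReal_im, zero_add]
    rw [h1]
    refine (Complex.abs_im_le_norm _).trans ?_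
    simp [hγn]
  have hre : ‖m‖ ≤ |m.re| + |m.im| := Complex.norm_le_abs_re_add_abs_im m
  have hbound (ε : ℝ) (hε : ε * m.re = |m.re|) (hε2 : ε = 1 ∨ ε = -1) :
      ‖m - ε * t‖ ≤ |‖p2‖ - t| + 2 * (‖h * p1 + a * p2‖ / ‖a‖) := by
    refine (Complex.norm_le_abs_re_add_abs_im _).trans ?_
    have e1 : (m - ε * t).im = m.im := by simp
    have e2 : |(m - ε * t).re| = |(|m.re| - t)| := by
      rw [← hε]
      rcases hε2 with rfl | rfl
      · simp
      · rw [← abs_neg]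
        congr 1
        simp
        ring
    rw [e1, e2, ← hmn]
    have : |(|m.re| - t)| ≤ |‖m‖ - t| + |m.im| := by
      calc |(|m.re| - t)| = |(‖m‖ - t) - (‖m‖ - (|m.re|))| := by congr 1; ring
        _ ≤ |‖m‖ - t| + |(‖m‖ - |m.re|)| := abs_sub _ _
        _ ≤ |‖m‖ - t| + |m.im| := by
          have := sub_nonneg.2 (Complex.abs_re_le_norm m)
          rw [abs_of_nonneg this]
          linarith
    linarith
  have hα : ‖(‖a‖ : ℂ) / a‖ = 1 := by simp [norm_ne_zero_iff.2 ha]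
  rcases le_total 0 m.re with hs | hs
  · refine ⟨(‖a‖ : ℂ) / a, Or.inl rfl, γ, hγn, hp1γ, ?_⟩
    have := hbound 1 (by rw [abs_of_nonneg hs, one_mul]) (Or.inl rfl)
    refine le_trans (le_of_eq ?_) this
    have e : p2 - γ * ((‖a‖ : ℂ) / a * t) = γ * ((‖a‖ : ℂ) / a) * (m - (1 : ℝ) * t) := by
      nth_rewrite 1 [hp2]; push_cast; ring
    rw [e, norm_mul, norm_mul, hγn, hα, one_mul, one_mul]
  · refine ⟨-((‖a‖ : ℂ) / a), Or.inr rfl, γ, hγn, hp1γ, ?_⟩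
    have := hbound (-1) (by rw [abs_of_nonpos hs]; ring) (Or.inr rfl)
    refine le_trans (le_of_eq ?_) this
    have e : p2 - γ * (-((‖a‖ : ℂ) / a) * t) = γ * ((‖a‖ : ℂ) / a) * (m - (-1 : ℝ) * t) := by
      nth_rewrite 1 [hp2]; push_cast; ring
    rw [e, norm_mul, norm_mul, hγn, hα, one_mul, one_mul]

lemma abs_sub_le_of_sq {u s σ b : ℝ} (hu : 0 ≤ u) (hσ : 0 < σ) (hs : σ ≤ s)
    (h : |u ^ 2 - s ^ 2| ≤ b) : |u - s| ≤ b / σ := by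
  rw [le_div_iff₀ hσ]
  have : u ^ 2 - s ^ 2 = (u - s) * (u + s) := by ring
  rw [this, abs_mul] at h
  refine le_trans ?_ h
  gcongr
  exact le_trans (by linarith) (le_abs_self _)

set_option maxHeartbeats 1600000 in
-- The norm and isotropy conditions form a linear system for `|p1|²`, `|p2|²` with determinant `c1 -
-- c2` up to sign, solved exactly by `s²`, `t²`; this gives the moduli. The phase comes from
-- `exists_ritz_direction` once `a` is bounded below. The vector `q` serves only for that lower
-- bound.
lemma exists_ritz_approx {K δ c1 c2 h1 h2 s t : ℝ} {a p1 p2 q1 q2 : ℂ} (hK : 1 ≤ K) (hδ : 0 ≤ δ)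
    (hδ1 : 16 * K ^ 7 * δ ≤ 1) (hc1l : 1 / K ≤ c1) (hc2l : c2 ≤ -(1 / K)) (hc1 : c1 ≤ K)
    (hc2 : -c2 ≤ K) (hs : 0 ≤ s) (ht : 0 ≤ t) (hst : s ^ 2 + t ^ 2 = 1)
    (hcst : c1 * s ^ 2 + c2 * t ^ 2 = 0)
    (hh1 : |h1| ≤ K) (hh2 : |h2| ≤ K) (ha : ‖a‖ ≤ K)
    (hq1 : ‖q1‖ ≤ K) (hq2 : ‖q2‖ ≤ K) (hpp : |c1 * ‖p1‖ ^ 2 + c2 * ‖p2‖ ^ 2| ≤ K * δ)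
    (hp : |‖p1‖ ^ 2 + ‖p2‖ ^ 2 - 1| ≤ K * δ)
    (hr1 : ‖h1 * p1 + a * p2‖ ≤ K * δ) (hr2 : ‖conj a * p1 + h2 * p2‖ ≤ K * δ)
    (hqq : 1 / K ≤ ‖conj q1 * (h1 * q1 + a * q2) + conj q2 * (conj a * q1 + h2 * q2)‖) :
    1 / (2 * K ^ 2) ≤ s ∧ 1 / (2 * K ^ 2) ≤ t ∧ 1 / (36 * K ^ 5) ≤ ‖a‖ ∧
    ∃ α : ℂ, (α = (‖a‖ : ℂ) / a ∨ α = -((‖a‖ : ℂ) / a)) ∧ ∃ r : ℝ, a * α = r ∧ |r| = ‖a‖ ∧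
      |h1 * s + r * t| ≤ 100 * K ^ 7 * δ ∧ |r * s + h2 * t| ≤ 100 * K ^ 7 * δ ∧
      ∃ γ : ℂ, ‖γ‖ = 1 ∧ ‖p1 - γ * s‖ ≤ 100 * K ^ 7 * δ ∧ ‖p2 - γ * (α * t)‖ ≤ 100 * K ^ 7 * δ := by
  have hK0 : 0 < K := by linarith
  have hKd : 1 / K * K = 1 := by field_simp
  have hkinv : 0 < 1 / K := by positivity
  have pw (i j : ℕ) (hij : i ≤ j) : K ^ i ≤ K ^ j := pow_le_pow_right₀ hK hij
  have hδpw (i : ℕ) (hi : i ≤ 7) : 16 * (K ^ i * δ) ≤ 1 := by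
    have := mul_le_mul_of_nonneg_right (pw i 7 hi) hδ
    linarith
  have hD : 2 / K ≤ c1 - c2 := by
    have : 2 / K = 1 / K + 1 / K := by ring
    linarith
  have hD0 : 0 < c1 - c2 := lt_of_lt_of_le (by positivity) hD
  have hσ0 : 0 < 1 / (2 * K ^ 2) := by positivity
  have hs2 : s ^ 2 * (c1 - c2) = -c2 := by linear_combination hcst - c2 * hst
  have ht2 : t ^ 2 * (c1 - c2) = c1 := by linear_combination -hcst + c1 * hst
  have hs1 : s ≤ 1 := by nlinarith only [hst, hs, sq_nonneg t]
  have ht1 : t ≤ 1 := by nlinarith only [hst, ht, sq_nonneg s]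
  have hsσ : 1 / (2 * K ^ 2) ≤ s := by
    have h1 : 1 / (2 * K ^ 2) ≤ s ^ 2 := by
      rw [div_le_iff₀ (by positivity)]
      have : 1 / K ≤ s ^ 2 * (2 * K) := by
        have : s ^ 2 * (c1 - c2) ≤ s ^ 2 * (2 * K) := by gcongr; linarith
        linarith
      have := mul_le_mul_of_nonneg_right this hK0.le
      linarith
    exact h1.trans (by nlinarith only [hs, hs1])
  have htσ : 1 / (2 * K ^ 2) ≤ t := by
    have h1 : 1 / (2 * K ^ 2) ≤ t ^ 2 := by
      rw [div_le_iff₀ (by positivity)]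
      have : 1 / K ≤ t ^ 2 * (2 * K) := by
        have : t ^ 2 * (c1 - c2) ≤ t ^ 2 * (2 * K) := by gcongr; linarith
        linarith
      have := mul_le_mul_of_nonneg_right this hK0.le
      linarith
    exact h1.trans (by nlinarith only [ht, ht1])
  have hnum (c : ℝ) (hc : |c| ≤ K) {e1 e2 : ℝ} (he1 : |e1| ≤ K * δ) (he2 : |e2| ≤ K * δ) :
      |e1 - c * e2| ≤ 2 * K ^ 2 * δ := by
    calc |e1 - c * e2| ≤ |e1| + |c * e2| := abs_sub _ _
      _ ≤ K * δ + K * (K * δ) := by rw [abs_mul]; gcongr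
      _ ≤ K ^ 2 * δ + K * (K * δ) := by gcongr; nlinarith only [hK]
      _ = _ := by ring
  have hdiv {u : ℝ} (hu : |u * (c1 - c2)| ≤ 2 * K ^ 2 * δ) : |u| ≤ K ^ 3 * δ := by
    rw [abs_mul, abs_of_pos hD0] at hu
    have h1 : |u| * (2 / K) ≤ 2 * K ^ 2 * δ := le_trans (by gcongr) hu
    have h2 := mul_le_mul_of_nonneg_right h1 hK0.le
    have h3 : |u| * (2 / K) * K = 2 * |u| := by field_simp
    rw [h3] at h2
    linarith
  have hp1s : |‖p1‖ - s| ≤ 2 * K ^ 5 * δ := by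
    have h1 : |‖p1‖ ^ 2 - s ^ 2| ≤ K ^ 3 * δ := by
      apply hdiv
      refine le_trans (le_of_eq ?_) (hnum c2 (abs_le.2 ⟨by linarith, by linarith⟩) hpp hp)
      congr 1
      linear_combination -hs2
    refine (abs_sub_le_of_sq (norm_nonneg _) hσ0 hsσ h1).trans (le_of_eq ?_)
    field_simp
  have hp2t : |‖p2‖ - t| ≤ 2 * K ^ 5 * δ := by
    have h1 : |‖p2‖ ^ 2 - t ^ 2| ≤ K ^ 3 * δ := by
      apply hdiv
      rw [← abs_neg]
      refine le_trans (le_of_eq ?_) (hnum c1 (abs_le.2 ⟨by linarith, by linarith⟩) hpp hp)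
      congr 1
      linear_combination ht2
    refine (abs_sub_le_of_sq (norm_nonneg _) hσ0 htσ h1).trans (le_of_eq ?_)
    field_simp
  have hsmall : 2 * K ^ 5 * δ ≤ 1 / (8 * K ^ 2) := by
    rw [le_div_iff₀ (by positivity)]; linarith
  have hhalf : 1 / (2 * K ^ 2) = 1 / (4 * K ^ 2) + 2 * (1 / (8 * K ^ 2)) := by field_simp; norm_num
  have h80 : 0 < 1 / (8 * K ^ 2) := by positivity
  have hp1l : 1 / (4 * K ^ 2) ≤ ‖p1‖ := by linarith [(abs_le.1 hp1s).1]
  have hp2l : 1 / (4 * K ^ 2) ≤ ‖p2‖ := by linarith [(abs_le.1 hp2t).1]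
  have h81 : 1 / (8 * K ^ 2) ≤ 1 := by
    rw [div_le_one (by positivity)]; nlinarith only [hK]
  have hp1u : ‖p1‖ ≤ 2 := by linarith [(abs_le.1 hp1s).2]
  have hp2u : ‖p2‖ ≤ 2 := by linarith [(abs_le.1 hp2t).2]
  have hdiag {h : ℝ} {u : ℝ} (hu : 1 / (4 * K ^ 2) ≤ u) (hh : |h| * u ≤ K * δ + 2 * ‖a‖) :
      |h| ≤ 4 * K ^ 2 * (K * δ + 2 * ‖a‖) := by
    have h1 : |h| * (1 / (4 * K ^ 2)) ≤ K * δ + 2 * ‖a‖ := le_trans (by gcongr) hh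
    have h2 := mul_le_mul_of_nonneg_left h1 (by positivity : 0 ≤ 4 * K ^ 2)
    have h3 : 4 * K ^ 2 * (|h| * (1 / (4 * K ^ 2))) = |h| := by field_simp
    linarith
  have hh1' : |h1| ≤ 4 * K ^ 2 * (K * δ + 2 * ‖a‖) := by
    refine hdiag hp1l ?_
    calc |h1| * ‖p1‖ = ‖(h1 * p1 + a * p2) - a * p2‖ := by simp
      _ ≤ ‖h1 * p1 + a * p2‖ + ‖a‖ * ‖p2‖ := by rw [← norm_mul]; exact norm_sub_le _ _
      _ ≤ K * δ + ‖a‖ * 2 := by gcongr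
      _ = _ := by ring
  have hh2' : |h2| ≤ 4 * K ^ 2 * (K * δ + 2 * ‖a‖) := by
    refine hdiag hp2l ?_
    calc |h2| * ‖p2‖ = ‖(conj a * p1 + h2 * p2) - conj a * p1‖ := by simp
      _ ≤ ‖conj a * p1 + h2 * p2‖ + ‖a‖ * ‖p1‖ := by
        rw [← RCLike.norm_conj a, ← norm_mul]; exact norm_sub_le _ _
      _ ≤ K * δ + ‖a‖ * 2 := by gcongr
      _ = _ := by ring
  -- If `a` were small, the two residuals, with `|p1|` and `|p2|` bounded below, would make `h1` and
  -- `h2` small too; the whole matrix would be small, against the lower bound on its form at `q`.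
  have hal : 1 / (36 * K ^ 5) ≤ ‖a‖ := by
    have e1 : 1 / K ≤ K * (|h1| * K + ‖a‖ * K) + K * (‖a‖ * K + |h2| * K) := by
      refine hqq.trans ?_
      refine (norm_add_le _ _).trans ?_
      rw [norm_mul, norm_mul, RCLike.norm_conj, RCLike.norm_conj]
      have b1 : ‖(h1 : ℂ) * q1 + a * q2‖ ≤ |h1| * K + ‖a‖ * K := by
        refine (norm_add_le _ _).trans ?_
        rw [norm_mul, norm_mul, Complex.norm_real, Real.norm_eq_abs]; gcongr
      have b2 : ‖conj a * q1 + (h2 : ℂ) * q2‖ ≤ ‖a‖ * K + |h2| * K := by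
        refine (norm_add_le _ _).trans ?_
        rw [norm_mul, norm_mul, RCLike.norm_conj, Complex.norm_real, Real.norm_eq_abs]; gcongr
      gcongr
    have e2 : 1 / K ≤ 8 * K ^ 5 * δ + 18 * K ^ 4 * ‖a‖ := by
      have b1 := mul_le_mul_of_nonneg_left hh1' (sq_nonneg K)
      have b2 := mul_le_mul_of_nonneg_left hh2' (sq_nonneg K)
      have b3 := mul_le_mul_of_nonneg_right (pw 2 4 (by norm_num)) (norm_nonneg a)
      linarith
    have e3 := mul_le_mul_of_nonneg_right e2 hK0.le
    rw [hKd] at e3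
    rw [div_le_iff₀ (by positivity)]
    linarith [hδpw 6 (by norm_num)]
  have ha0 : 0 < ‖a‖ := lt_of_lt_of_le (by positivity) hal
  have ha0' : a ≠ 0 := norm_pos_iff.1 ha0
  have hp10 : p1 ≠ 0 := norm_pos_iff.1 (lt_of_lt_of_le (by positivity) hp1l)
  refine ⟨hsσ, htσ, hal, ?_⟩
  obtain ⟨α, hα, γ, hγ, hpγ, hp2γ⟩ := exists_ritz_direction (p2 := p2) h1 t ha0' hp10
  obtain ⟨r, har, hr⟩ : ∃ r : ℝ, a * α = r ∧ |r| = ‖a‖ := by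
    rcases hα with rfl | rfl
    · exact ⟨‖a‖, by field_simp, by simp⟩
    · exact ⟨-‖a‖, by push_cast; field_simp, by simp⟩
  have hαn : ‖α‖ = 1 := by
    rcases hα with rfl | rfl <;> simp [ha0.ne']
  have hαα : conj α * α = 1 := by
    rw [← Complex.normSq_eq_conj_mul_self, Complex.normSq_eq_norm_sq, hαn]; simp
  have har' : conj α * conj a = r := by
    rw [mul_comm, ← map_mul, har, Complex.conj_ofReal]
  have hg1 : ‖p1 - γ * s‖ ≤ 2 * K ^ 5 * δ := by
    refine le_trans (le_of_eq ?_) hp1s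
    have : p1 - γ * s = γ * ((‖p1‖ - s : ℝ) : ℂ) := by
      nth_rewrite 1 [hpγ]; push_cast; ring
    rw [this, norm_mul, hγ, one_mul, Complex.norm_real, Real.norm_eq_abs]
  have hg2 : ‖p2 - γ * (α * t)‖ ≤ 74 * K ^ 6 * δ := by
    refine hp2γ.trans ?_
    have : ‖h1 * p1 + a * p2‖ / ‖a‖ ≤ 36 * K ^ 6 * δ := by
      rw [div_le_iff₀ ha0]
      refine hr1.trans ?_
      calc K * δ = 36 * K ^ 6 * δ * (1 / (36 * K ^ 5)) := by field_simp
        _ ≤ _ := by gcongr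
    have := mul_le_mul_of_nonneg_right (pw 5 6 (by norm_num)) hδ
    linarith
  have w1 := mul_le_mul_of_nonneg_right (pw 1 7 (by norm_num)) hδ
  have w5 := mul_le_mul_of_nonneg_right (pw 5 7 (by norm_num)) hδ
  have w6 := mul_le_mul_of_nonneg_right (pw 6 7 (by norm_num)) hδ
  have w7 : 0 ≤ K ^ 7 * δ := by positivity
  have hres {b d : ℂ} (hb : ‖b‖ ≤ K) (hd : ‖d‖ ≤ K) (hbd : ‖b * p1 + d * p2‖ ≤ K * δ) :
      ‖b * s + d * (α * t)‖ ≤ 100 * K ^ 7 * δ := by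
    have e : ‖b * s + d * (α * t)‖ = ‖γ * (b * s + d * (α * t))‖ := by
      rw [norm_mul, hγ, one_mul]
    have e2 : γ * (b * s + d * (α * t)) =
        (b * p1 + d * p2) - b * (p1 - γ * s) - d * (p2 - γ * (α * t)) := by ring
    rw [e, e2]
    calc _ ≤ ‖b * p1 + d * p2‖ + ‖b * (p1 - γ * s)‖ + ‖d * (p2 - γ * (α * t))‖ :=
          (norm_sub_le _ _).trans (add_le_add_left (norm_sub_le _ _) _)
      _ ≤ K * δ + K * (2 * K ^ 5 * δ) + K * (74 * K ^ 6 * δ) := by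
        rw [norm_mul, norm_mul]; gcongr
      _ ≤ _ := by linarith
  refine ⟨α, hα, r, har, hr, ?_, ?_, γ, hγ, by linarith, by linarith⟩
  · have := hres (by simpa using hh1) ha hr1
    rwa [← mul_assoc, har, ← Complex.ofReal_mul, ← Complex.ofReal_mul, ← Complex.ofReal_add,
      Complex.norm_real, Real.norm_eq_abs] at this
  · have := hres (by simpa using ha) (by simpa using hh2) hr2
    have e : conj a * s + h2 * (α * t) = α * ((r * s + h2 * t : ℝ) : ℂ) := by
      push_cast
      rw [← har']
      linear_combination (-(conj a * s)) * hαα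
    rwa [e, norm_mul, hαn, one_mul, Complex.norm_real, Real.norm_eq_abs] at this

/-! ### Compression to the plane and the two Ritz triplets. -/

variable {V : Matrix (Fin n) (Fin 2) ℂ}

lemma dotProduct_mulVec_compress (M : Matrix (Fin n) (Fin n) ℂ) (V : Matrix (Fin n) (Fin 2) ℂ)
    (p q : Fin 2 → ℂ) :
    star (V *ᵥ p) ⬝ᵥ (M *ᵥ (V *ᵥ q)) = star p ⬝ᵥ (compress M V *ᵥ q) := by
  rw [compress, star_mulVec, ← dotProduct_mulVec, mulVec_mulVec, mulVec_mulVec]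

lemma compress_one (hV : Vᴴ * V = 1) : compress 1 V = 1 := by
  rw [compress, Matrix.mul_one, hV]

lemma norm_toLp_sq {m : ℕ} (u : Fin m → ℂ) : ((‖WithLp.toLp 2 u‖ ^ 2 : ℝ) : ℂ) = star u ⬝ᵥ u := by
  rw [dotProduct_comm, ← EuclideanSpace.inner_toLp_toLp, inner_self_eq_norm_sq_to_K]
  simp

lemma norm_mulVec_sq (hV : Vᴴ * V = 1) (p : Fin 2 → ℂ) :
    ‖WithLp.toLp 2 (V *ᵥ p)‖ ^ 2 = ‖p 0‖ ^ 2 + ‖p 1‖ ^ 2 := by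
  have h1 : ‖WithLp.toLp 2 (V *ᵥ p)‖ ^ 2 = ‖WithLp.toLp 2 p‖ ^ 2 := by
    apply Complex.ofReal_injective
    rw [norm_toLp_sq, norm_toLp_sq]
    have := dotProduct_mulVec_compress 1 V p p
    rwa [compress_one hV, one_mulVec, one_mulVec] at this
  rw [h1, EuclideanSpace.norm_sq_eq, Fin.sum_univ_two]

lemma norm_mulVec_single (hV : Vᴴ * V = 1) (i : Fin 2) :
    ‖WithLp.toLp 2 (V *ᵥ Pi.single i 1)‖ = 1 := by
  have h := norm_mulVec_sq hV (Pi.single i 1)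
  have h2 : ‖WithLp.toLp 2 (V *ᵥ Pi.single i 1)‖ ^ 2 = 1 := by
    rw [h]; fin_cases i <;> simp
  nlinarith [norm_nonneg (WithLp.toLp 2 (V *ᵥ Pi.single i 1))]

lemma norm_compress_apply_le (hV : Vᴴ * V = 1) (M : Matrix (Fin n) (Fin n) ℂ) (i j : Fin 2) :
    ‖compress M V i j‖ ≤ ‖M‖ := by
  have h := norm_dotProduct_mulVec_le M (V *ᵥ Pi.single i 1) (V *ᵥ Pi.single j 1)
  rw [norm_mulVec_single hV, norm_mulVec_single hV, dotProduct_mulVec_compress, ← Pi.single_star] at h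
  simpa using h

lemma norm_compress_mulVec_apply_le (hV : Vᴴ * V = 1) (M : Matrix (Fin n) (Fin n) ℂ)
    (p : Fin 2 → ℂ) (i : Fin 2) :
    ‖(compress M V *ᵥ p) i‖ ≤ ‖WithLp.toLp 2 (M *ᵥ (V *ᵥ p))‖ := by
  have h : (compress M V *ᵥ p) i = star (V *ᵥ Pi.single i 1) ⬝ᵥ (M *ᵥ (V *ᵥ p)) := by
    rw [dotProduct_mulVec_compress, ← Pi.single_star]; simp
  rw [h, dotProduct_comm, ← EuclideanSpace.inner_toLp_toLp]
  refine (norm_inner_le_norm _ _).trans ?_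
  rw [norm_mulVec_single hV, one_mul]

lemma compress_apply_one_zero {M : Matrix (Fin n) (Fin n) ℂ} (hM : M.IsHermitian) :
    compress M V 1 0 = conj (compress M V 0 1) := by
  have h : (compress M V).IsHermitian := isHermitian_conjTranspose_mul_mul V hM
  exact (h.apply 1 0).symm

lemma compress_apply_self {M : Matrix (Fin n) (Fin n) ℂ} (hM : M.IsHermitian) (i : Fin 2) :
    compress M V i i = ((compress M V i i).re : ℂ) := by
  have h : (compress M V).IsHermitian := isHermitian_conjTranspose_mul_mul V hM
  exact (h.coe_re_apply_self i).symm

lemma compress_pencil (hV : Vᴴ * V = 1) (μ lam : ℝ) :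
    compress (A - (μ : ℂ) • C - (lam : ℂ) • 1) V =
      compress A V - (μ : ℂ) • compress C V - (lam : ℂ) • 1 := by
  rw [← hV]
  simp [compress, Matrix.mul_sub, Matrix.sub_mul]

/-- For a unimodular `α` making `a₁₂ α` real, the phase cancels and the Ritz value is a real
quadratic form in the two square roots. Changing the sign of `α` changes only the sign of `r`. -/
lemma ritzTheta_eq (hA : A.IsHermitian) {α : ℂ} {r : ℝ} (hα : ‖α‖ = 1) (hr : a₁₂ A V * α = r) :
    ritzTheta A C V α = (((compress A V 0 0).re * Real.sqrt (-c₂ C V / (c₁ C V - c₂ C V)) ^ 2 +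
      2 * r * Real.sqrt (-c₂ C V / (c₁ C V - c₂ C V)) * Real.sqrt (c₁ C V / (c₁ C V - c₂ C V)) +
      (compress A V 1 1).re * Real.sqrt (c₁ C V / (c₁ C V - c₂ C V)) ^ 2 : ℝ) : ℂ) := by
  have hαα : conj α * α = 1 := by
    rw [← Complex.normSq_eq_conj_mul_self, Complex.normSq_eq_norm_sq, hα]; simp
  have hr' : conj α * conj (a₁₂ A V) = r := by
    rw [mul_comm, ← map_mul, hr, Complex.conj_ofReal]
  rw [a₁₂] at hr hr'
  simp only [ritzTheta, ritzZ, dotProduct, mulVec, Fin.sum_univ_two]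
  rw [compress_apply_one_zero hA, compress_apply_self hA 0, compress_apply_self hA 1]
  simp
  set s : ℂ := ((Real.sqrt (-c₂ C V / (c₁ C V - c₂ C V)) : ℝ) : ℂ)
  set t : ℂ := ((Real.sqrt (c₁ C V / (c₁ C V - c₂ C V)) : ℝ) : ℂ)
  linear_combination s * t * hr + s * t * hr' + ((compress A V 1 1).re : ℂ) * t ^ 2 * hαα

lemma ritzNu_eq (hA : A.IsHermitian)
    (hd : compress C V = diagonal ![(c₁ C V : ℂ), (c₂ C V : ℂ)]) {α : ℂ} {r s t : ℝ}
    (hs : s = Real.sqrt (-c₂ C V / (c₁ C V - c₂ C V)))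
    (ht : t = Real.sqrt (c₁ C V / (c₁ C V - c₂ C V)))
    (hα : ‖α‖ = 1) (hr : a₁₂ A V * α = r) :
    ritzNu A C V α = (((c₁ C V * s * ((compress A V 0 0).re * s + r * t) +
        c₂ C V * t * (r * s + (compress A V 1 1).re * t)) /
      ((c₁ C V) ^ 2 * s ^ 2 + (c₂ C V) ^ 2 * t ^ 2) : ℝ) : ℂ) := by
  have hαα : conj α * α = 1 := by
    rw [← Complex.normSq_eq_conj_mul_self, Complex.normSq_eq_norm_sq, hα]; simp
  have hr' : conj α * conj (a₁₂ A V) = r := by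
    rw [mul_comm, ← map_mul, hr, Complex.conj_ofReal]
  rw [a₁₂] at hr hr'
  rw [ritzNu, Complex.ofReal_div]
  congr 1
  · simp only [ritzZ, dotProduct, ← mulVec_mulVec]
    rw [hd]
    simp only [Fin.sum_univ_two, mulVec, dotProduct]
    rw [compress_apply_one_zero hA, compress_apply_self hA 0, compress_apply_self hA 1, ← hs, ← ht]
    simp
    linear_combination (c₁ C V) * s * t * hr + (c₂ C V) * s * t * hr' +
      (c₂ C V) * ((compress A V 1 1).re : ℂ) * t ^ 2 * hαα
  · congr 1
    rw [EuclideanSpace.norm_sq_eq, hd, Fin.sum_univ_two]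
    simp [ritzZ, mulVec_diagonal, ← hs, ← ht, hα, mul_pow]

lemma dotProduct_compress_mulVec_of_diag
    (hd : compress C V = diagonal ![(c₁ C V : ℂ), (c₂ C V : ℂ)]) (p q : Fin 2 → ℂ) :
    star (V *ᵥ p) ⬝ᵥ (C *ᵥ (V *ᵥ q)) =
      c₁ C V * conj (p 0) * q 0 + c₂ C V * conj (p 1) * q 1 := by
  rw [dotProduct_mulVec_compress, hd]
  simp [dotProduct, mulVec_diagonal, Fin.sum_univ_two]
  ring

/-- This converts the two-by-two estimates into statements about Ritz triplets. Compressing the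
shifted pencil `B` leaves the off-diagonal entry `a₁₂` unchanged because `C_k` is diagonal, so `α`
is the same for `A_k` and for `Vᴴ B V`. -/
lemma exists_ritz_pair {K δ μs lams : ℝ} (hA : A.IsHermitian) (hC : C.IsHermitian) (hK : 1 ≤ K)
    (hδ : 0 ≤ δ) (hδ1 : 16 * (32 * K ^ 3) ^ 7 * δ ≤ 1) (hV : Vᴴ * V = 1)
    (hd : compress C V = diagonal ![(c₁ C V : ℂ), (c₂ C V : ℂ)]) (h12 : c₂ C V ≤ c₁ C V)
    (hCK : ‖C‖ ≤ K) (hBK : ‖A - (μs : ℂ) • C - (lams : ℂ) • 1‖ ≤ K) {p q : Fin 2 → ℂ}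
    (hq : ‖WithLp.toLp 2 (V *ᵥ q)‖ ≤ K) (hpn : |‖WithLp.toLp 2 (V *ᵥ p)‖ ^ 2 - 1| ≤ K * δ)
    (hpp : ‖star (V *ᵥ p) ⬝ᵥ (C *ᵥ (V *ᵥ p))‖ ≤ K * δ)
    (hpq : 1 / 2 ≤ ‖star (V *ᵥ p) ⬝ᵥ (C *ᵥ (V *ᵥ q))‖)
    (hBp : ‖WithLp.toLp 2 ((A - (μs : ℂ) • C - (lams : ℂ) • 1) *ᵥ (V *ᵥ p))‖ ≤ K * δ)
    (hBq : 1 / K ≤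
      ‖star (V *ᵥ q) ⬝ᵥ ((A - (μs : ℂ) • C - (lams : ℂ) • 1) *ᵥ (V *ᵥ q))‖) :
    0 < c₁ C V ∧ c₂ C V < 0 ∧ a₁₂ A V ≠ 0 ∧ ∃ α ∈ ritzAlphas A V,
    ∃ ν θ ν' θ' : ℝ, ritzNu A C V α = ν ∧ ritzTheta A C V α = θ ∧
      ritzNu A C V (-α) = ν' ∧ ritzTheta A C V (-α) = θ' ∧
      |ν - μs| ≤ 200 * (32 * K ^ 3) ^ 10 * δ ∧ |θ - lams| ≤ 200 * (32 * K ^ 3) ^ 7 * δ ∧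
      1 / (36 * (32 * K ^ 3) ^ 9) ≤ |θ - θ'| ∧
      ((θ - lams : ℝ) : ℂ) = star (ritzVec C V α).ofLp ⬝ᵥ
        ((A - (μs : ℂ) • C - (lams : ℂ) • 1) *ᵥ (ritzVec C V α).ofLp) ∧
      ∃ γ : ℂ, ‖γ‖ = 1 ∧
        ‖WithLp.toLp 2 (V *ᵥ p) - γ • ritzVec C V α‖ ≤ 200 * (32 * K ^ 3) ^ 7 * δ := by
  have hK0 : 0 < K := by linarith
  have hKK : K ≤ 32 * K ^ 3 := by
    have := pow_le_pow_right₀ hK (show 1 ≤ 3 by norm_num)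
    linarith
  -- The bound `1/(32K³)` on `c₁` and `-c₂` becomes `1/L`; as `K ≤ L`, the single constant `L` then
  -- serves in all hypotheses of `exists_ritz_approx`.
  set L := 32 * K ^ 3 with hL
  have hL1 : 1 ≤ L := hK.trans hKK
  have hL0 : 0 < L := by linarith
  set B := A - (μs : ℂ) • C - (lams : ℂ) • 1 with hBdef
  have hB : B.IsHermitian := isHermitian_pencil hA hC μs lams
  have hKδ : K * δ ≤ L * δ := by gcongr
  have hLpw : L * δ ≤ L ^ 7 * δ := by
    have := pow_le_pow_right₀ hL1 (show 1 ≤ 7 by norm_num)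
    rw [pow_one] at this
    gcongr
  have hcomp : compress B V = compress A V - (μs : ℂ) • compress C V - (lams : ℂ) • 1 :=
    compress_pencil hV μs lams
  have hc1 : |c₁ C V| ≤ K :=
    (Complex.abs_re_le_norm _).trans ((norm_compress_apply_le hV C 0 0).trans hCK)
  have hc2 : |c₂ C V| ≤ K :=
    (Complex.abs_re_le_norm _).trans ((norm_compress_apply_le hV C 1 1).trans hCK)
  have hqs := norm_mulVec_sq hV q
  have hq2 : ‖WithLp.toLp 2 (V *ᵥ q)‖ ^ 2 ≤ K ^ 2 := by gcongr
  have hq0 : ‖q 0‖ ≤ K := by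
    refine (sq_le_sq₀ (norm_nonneg _) hK0.le).1 ?_
    nlinarith only [hqs, hq2, sq_nonneg ‖q 1‖]
  have hq1 : ‖q 1‖ ≤ K := by
    refine (sq_le_sq₀ (norm_nonneg _) hK0.le).1 ?_
    nlinarith only [hqs, hq2, sq_nonneg ‖q 0‖]
  rw [norm_mulVec_sq hV p] at hpn
  rw [dotProduct_compress_mulVec_of_diag hd] at hpq
  have hpp' : |c₁ C V * ‖p 0‖ ^ 2 + c₂ C V * ‖p 1‖ ^ 2| ≤ K * δ := by
    refine le_trans (le_of_eq ?_) hpp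
    rw [dotProduct_compress_mulVec_of_diag hd, mul_assoc, mul_assoc,
      ← Complex.normSq_eq_conj_mul_self, ← Complex.normSq_eq_conj_mul_self,
      Complex.normSq_eq_norm_sq, Complex.normSq_eq_norm_sq, ← Complex.ofReal_mul,
      ← Complex.ofReal_mul, ← Complex.ofReal_add, Complex.norm_real, Real.norm_eq_abs]
  have hδK (i : ℕ) (hi : i ≤ 7) : 16 * L ^ i * δ ≤ 1 := by
    refine le_trans ?_ hδ1
    gcongr
  obtain ⟨hc1l, hc2l⟩ := indefinite_of_isotropic_pair hK (by
      refine le_trans ?_ (hδK 4 (by norm_num))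
      gcongr) h12 hc1 hc2 hq0 hq1 hpp' (by
      have h1 := (abs_le.1 hpn).2
      have h2 := hδK 1 (by norm_num)
      linarith) hpq
  rw [← hL] at hc1l hc2l
  have hLi : 0 < 1 / L := by positivity
  have hc1p : 0 < c₁ C V := by linarith
  have hc2n : c₂ C V < 0 := by linarith
  have hD : 0 < c₁ C V - c₂ C V := by linarith
  obtain ⟨s, hs⟩ : ∃ s, s = Real.sqrt (-c₂ C V / (c₁ C V - c₂ C V)) := ⟨_, rfl⟩
  obtain ⟨t, ht⟩ : ∃ t, t = Real.sqrt (c₁ C V / (c₁ C V - c₂ C V)) := ⟨_, rfl⟩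
  have hs0 : 0 ≤ s := hs ▸ Real.sqrt_nonneg _
  have ht0 : 0 ≤ t := ht ▸ Real.sqrt_nonneg _
  have hs2 : s ^ 2 = -c₂ C V / (c₁ C V - c₂ C V) := by
    rw [hs, Real.sq_sqrt]
    exact div_nonneg (by linarith) hD.le
  have ht2 : t ^ 2 = c₁ C V / (c₁ C V - c₂ C V) := by
    rw [ht, Real.sq_sqrt]
    exact div_nonneg hc1p.le hD.le
  have hst : s ^ 2 + t ^ 2 = 1 := by rw [hs2, ht2]; field_simp; ring
  have hcst : c₁ C V * s ^ 2 + c₂ C V * t ^ 2 = 0 := by rw [hs2, ht2]; field_simp; ring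
  set h1 : ℝ := (compress A V 0 0).re - μs * c₁ C V - lams with hh1
  set h2 : ℝ := (compress A V 1 1).re - μs * c₂ C V - lams with hh2
  have hB00 : compress B V 0 0 = h1 := by
    rw [hcomp, hd, hh1]; simp [← compress_apply_self hA 0]
  have hB11 : compress B V 1 1 = h2 := by
    rw [hcomp, hd, hh2]; simp [← compress_apply_self hA 1]
  have hB01 : compress B V 0 1 = a₁₂ A V := by
    rw [hcomp, hd, a₁₂]; simp
  have hB10 : compress B V 1 0 = conj (a₁₂ A V) := by
    rw [compress_apply_one_zero hB, hB01]
  have hBv0 (z : Fin 2 → ℂ) : (compress B V *ᵥ z) 0 = h1 * z 0 + a₁₂ A V * z 1 := by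
    simp [mulVec, dotProduct, Fin.sum_univ_two, hB00, hB01]
  have hBv1 (z : Fin 2 → ℂ) : (compress B V *ᵥ z) 1 = conj (a₁₂ A V) * z 0 + h2 * z 1 := by
    simp [mulVec, dotProduct, Fin.sum_univ_two, hB10, hB11]
  have hBe (i j : Fin 2) : ‖compress B V i j‖ ≤ L :=
    ((norm_compress_apply_le hV B i j).trans hBK).trans hKK
  obtain ⟨hsl, htl, hal, α, hα, r, har, hr, hr1, hr2, γ, hγ, hγ1, hγ2⟩ :=
    exists_ritz_approx (a := a₁₂ A V) (p1 := p 0) (p2 := p 1) (q1 := q 0) (q2 := q 1)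
      (h1 := h1) (h2 := h2) (c1 := c₁ C V) (c2 := c₂ C V) hL1 hδ hδ1 hc1l hc2l
      (((le_abs_self _).trans hc1).trans hKK) (((neg_le_abs _).trans hc2).trans hKK) hs0 ht0 hst
      hcst (by simpa [hB00] using hBe 0 0) (by simpa [hB11] using hBe 1 1)
      (by simpa [hB01] using hBe 0 1) (hq0.trans hKK) (hq1.trans hKK) (hpp'.trans hKδ)
      (hpn.trans hKδ)
      (by rw [← hBv0]; exact ((norm_compress_mulVec_apply_le hV B p 0).trans hBp).trans hKδ)
      (by rw [← hBv1]; exact ((norm_compress_mulVec_apply_le hV B p 1).trans hBp).trans hKδ)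
      (by
        have e : star (V *ᵥ q) ⬝ᵥ (B *ᵥ (V *ᵥ q)) =
            conj (q 0) * (h1 * q 0 + a₁₂ A V * q 1) +
              conj (q 1) * (conj (a₁₂ A V) * q 0 + h2 * q 1) := by
          rw [dotProduct_mulVec_compress, ← hBv0, ← hBv1]
          simp [dotProduct, Fin.sum_univ_two]
        rw [← e]
        refine le_trans ?_ hBq
        gcongr)
  have ha0 : 0 < ‖a₁₂ A V‖ := lt_of_lt_of_le (by positivity) hal
  have ha : a₁₂ A V ≠ 0 := norm_pos_iff.1 ha0
  have hαn : ‖α‖ = 1 := by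
    rcases hα with rfl | rfl <;> simp [ha0.ne']
  have hαn' : ‖-α‖ = 1 := by rwa [norm_neg]
  have har' : a₁₂ A V * -α = ((-r : ℝ) : ℂ) := by rw [mul_neg, har]; push_cast; ring
  have hν := ritzNu_eq hA hd hs ht hαn har
  have hν' := ritzNu_eq hA hd hs ht hαn' har'
  have hθ := ritzTheta_eq (C := C) hA hαn har
  have hθ' := ritzTheta_eq (C := C) hA hαn' har'
  rw [← hs, ← ht] at hθ hθ'
  have hs1 : s ≤ 1 := by nlinarith only [hst, hs0, sq_nonneg t]
  have ht1 : t ≤ 1 := by nlinarith only [hst, ht0, sq_nonneg s]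
  have hz : ritzZ C V α = ![(s : ℂ), α * t] := by rw [ritzZ, hs, ht]
  refine ⟨hc1p, hc2n, ha, α, hα, _, _, _, _, hν, hθ, hν', hθ', ?_, ?_, ?_, ?_, γ, hγ, ?_⟩
  · have hQ : 1 / L ^ 2 ≤ c₁ C V ^ 2 * s ^ 2 + c₂ C V ^ 2 * t ^ 2 := by
      have e1 : (1 / L) ^ 2 ≤ c₁ C V ^ 2 := by gcongr
      have e2 : (1 / L) ^ 2 ≤ c₂ C V ^ 2 := by
        rw [← neg_sq (c₂ C V)]; gcongr; linarith
      calc 1 / L ^ 2 = (1 / L) ^ 2 * s ^ 2 + (1 / L) ^ 2 * t ^ 2 := by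
            rw [← mul_add, hst, mul_one, _root_.one_div_pow]
        _ ≤ _ := by gcongr
    have hQ0 : 0 < c₁ C V ^ 2 * s ^ 2 + c₂ C V ^ 2 * t ^ 2 := lt_of_lt_of_le (by positivity) hQ
    -- Isotropy of `z(α)` removes the `lams` contribution, so the error of `ν` is a combination of
    -- the two small residual components of `Vᴴ B V` at `z(α)`.
    have e : (c₁ C V * s * ((compress A V 0 0).re * s + r * t) +
        c₂ C V * t * (r * s + (compress A V 1 1).re * t)) /
        (c₁ C V ^ 2 * s ^ 2 + c₂ C V ^ 2 * t ^ 2) - μs =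
        (c₁ C V * s * (h1 * s + r * t) + c₂ C V * t * (r * s + h2 * t)) /
        (c₁ C V ^ 2 * s ^ 2 + c₂ C V ^ 2 * t ^ 2) := by
      rw [div_sub' hQ0.ne', hh1, hh2]
      congr 1
      linear_combination lams * hcst
    rw [e, abs_div, abs_of_pos hQ0, div_le_iff₀ hQ0]
    calc _ ≤ |c₁ C V * s * (h1 * s + r * t)| + |c₂ C V * t * (r * s + h2 * t)| := abs_add_le _ _
      _ = |c₁ C V| * s * |h1 * s + r * t| + |c₂ C V| * t * |r * s + h2 * t| := by
        rw [abs_mul, abs_mul, abs_mul, abs_mul, abs_of_nonneg hs0, abs_of_nonneg ht0]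
      _ ≤ L * 1 * (100 * L ^ 7 * δ) + L * 1 * (100 * L ^ 7 * δ) := by
        gcongr
        · exact hc1.trans hKK
        · exact hc2.trans hKK
      _ = 200 * L ^ 10 * δ * (1 / L ^ 2) := by field_simp; ring
      _ ≤ _ := by gcongr
  · have e : (compress A V 0 0).re * s ^ 2 + 2 * r * s * t + (compress A V 1 1).re * t ^ 2 - lams =
        s * (h1 * s + r * t) + t * (r * s + h2 * t) := by
      rw [hh1, hh2]
      linear_combination μs * hcst + lams * hst
    rw [e]
    calc _ ≤ |s * (h1 * s + r * t)| + |t * (r * s + h2 * t)| := abs_add_le _ _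
      _ = s * |h1 * s + r * t| + t * |r * s + h2 * t| := by
        rw [abs_mul, abs_mul, abs_of_nonneg hs0, abs_of_nonneg ht0]
      _ ≤ 1 * (100 * L ^ 7 * δ) + 1 * (100 * L ^ 7 * δ) := by gcongr
      _ = _ := by ring
  -- The two Ritz values differ by `4 r s t`, and `|r| = |a₁₂|`, `s`, `t` are all bounded below.
  · have e : (compress A V 0 0).re * s ^ 2 + 2 * r * s * t + (compress A V 1 1).re * t ^ 2 -
        ((compress A V 0 0).re * s ^ 2 + 2 * -r * s * t + (compress A V 1 1).re * t ^ 2) =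
        4 * r * s * t := by ring
    rw [e, abs_mul, abs_mul, abs_mul, hr, abs_of_nonneg hs0, abs_of_nonneg ht0]
    calc 1 / (36 * L ^ 9) = |4| * (1 / (36 * L ^ 5)) * (1 / (2 * L ^ 2)) * (1 / (2 * L ^ 2)) := by
          rw [abs_of_pos (by norm_num : (0 : ℝ) < 4)]; field_simp; norm_num
      _ ≤ _ := by gcongr
  · have hα2 : conj α * α = 1 := by
      rw [← Complex.normSq_eq_conj_mul_self, Complex.normSq_eq_norm_sq, hαn]; simp
    have hca : conj α * conj (a₁₂ A V) = r := by
      rw [mul_comm, ← map_mul, har, Complex.conj_ofReal]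
    have hcst' : (c₁ C V : ℂ) * s ^ 2 + c₂ C V * t ^ 2 = 0 := by exact_mod_cast hcst
    have hst' : (s : ℂ) ^ 2 + t ^ 2 = 1 := by exact_mod_cast hst
    simp only [ritzVec]
    rw [dotProduct_mulVec_compress, hz]
    simp only [dotProduct, Fin.sum_univ_two, hBv0, hBv1]
    simp [hh1, hh2]
    linear_combination (-(s : ℂ) * t) * har - (s : ℂ) * t * hca -
      ((compress A V 1 1).re - μs * c₂ C V - lams) * (t : ℂ) ^ 2 * hα2 + μs * hcst' + lams * hst'
  · have hvec : WithLp.toLp 2 (V *ᵥ p) - γ • ritzVec C V α =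
        WithLp.toLp 2 (V *ᵥ (p - γ • ritzZ C V α)) := by
      rw [ritzVec, mulVec_sub, mulVec_smul]; rfl
    rw [hvec]
    refine (sq_le_sq₀ (norm_nonneg _) (by positivity)).1 ?_
    rw [norm_mulVec_sq hV, hz]
    simp only [Pi.sub_apply, Pi.smul_apply, smul_eq_mul, cons_val_zero, cons_val_one]
    have w : 0 ≤ 100 * L ^ 7 * δ := by positivity
    calc _ ≤ (100 * L ^ 7 * δ) ^ 2 + (100 * L ^ 7 * δ) ^ 2 := by gcongr
      _ ≤ (2 * (100 * L ^ 7 * δ)) ^ 2 := by nlinarith only [w]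
      _ = _ := by ring

/-! ### Distance of `g` and `y` from the projection plane, and the error of one step. -/

lemma norm_dotProduct_sub_mulVec_sub_le (M : Matrix (Fin n) (Fin n) ℂ) (u v e f : Fin n → ℂ) :
    ‖star (u - e) ⬝ᵥ (M *ᵥ (v - f)) - star u ⬝ᵥ (M *ᵥ v)‖ ≤
      ‖M‖ * (‖WithLp.toLp 2 u‖ * ‖WithLp.toLp 2 f‖ + ‖WithLp.toLp 2 e‖ * ‖WithLp.toLp 2 v‖ +
        ‖WithLp.toLp 2 e‖ * ‖WithLp.toLp 2 f‖) := by
  have h : star (u - e) ⬝ᵥ (M *ᵥ (v - f)) - star u ⬝ᵥ (M *ᵥ v) =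
      star e ⬝ᵥ (M *ᵥ f) - star u ⬝ᵥ (M *ᵥ f) - star e ⬝ᵥ (M *ᵥ v) := by
    simp only [star_sub, mulVec_sub, sub_dotProduct, dotProduct_sub]; ring
  rw [h]
  refine (norm_sub_le _ _).trans ((add_le_add_left (norm_sub_le _ _) _).trans ?_)
  have h1 := norm_dotProduct_mulVec_le M e f
  have h2 := norm_dotProduct_mulVec_le M u f
  have h3 := norm_dotProduct_mulVec_le M e v
  linarith

lemma norm_toLp_mulVec_le (M : Matrix (Fin n) (Fin n) ℂ) (v : Fin n → ℂ) :
    ‖WithLp.toLp 2 (M *ᵥ v)‖ ≤ ‖M‖ * ‖WithLp.toLp 2 v‖ :=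
  Matrix.l2_opNorm_mulVec M (WithLp.toLp 2 v)

/-- A vector lies in the plane when the current pencil maps it into the span of `C x` and `x`. For
`g` the defect involves only products of a parameter error with `x - g`, hence `ε²`; for `y` the
parameter errors act on `y` itself, hence `ε`. The correctors `e` and `f` are lifts of these
defects. -/
lemma exists_near_projection {μs lams μ lam M ε : ℝ} {g x : EuclideanSpace ℂ (Fin n)}
    {y : Fin n → ℂ} {t : ℂ} (hM : 0 ≤ M) (hε : 0 ≤ ε) (hg : IsEigentriplet A C μs lams g)
    (hy : (A - (μs : ℂ) • C - (lams : ℂ) • 1) *ᵥ y = t • (C *ᵥ g.ofLp))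
    (hlift : ∀ r : Fin n → ℂ, ∃ (e : Fin n → ℂ) (a b : ℂ),
      (A - (μ : ℂ) • C - (lam : ℂ) • 1) *ᵥ e - a • (C *ᵥ x.ofLp) - b • x.ofLp = r ∧
        ‖WithLp.toLp 2 e‖ ≤ M * ‖WithLp.toLp 2 r‖)
    (hμ : |μ - μs| ≤ ε) (hlam : |lam - lams| ≤ ε) (hx : ‖x - g‖ ≤ ε) :
    ∃ e f : Fin n → ℂ,
      (∃ a b : ℂ, (A - (μ : ℂ) • C - (lam : ℂ) • 1) *ᵥ (g.ofLp - e) - a • (C *ᵥ x.ofLp)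
        - b • x.ofLp = 0) ∧
      (∃ a b : ℂ, (A - (μ : ℂ) • C - (lam : ℂ) • 1) *ᵥ (y - f) - a • (C *ᵥ x.ofLp)
        - b • x.ofLp = 0) ∧
      ‖WithLp.toLp 2 e‖ ≤ M * (‖C‖ + 1) * ε ^ 2 ∧
      ‖WithLp.toLp 2 f‖ ≤ M * ((‖C‖ + 1) * ‖WithLp.toLp 2 y‖ + ‖t‖ * ‖C‖) * ε := by
  have hB (v : Fin n → ℂ) : (A - (μ : ℂ) • C - (lam : ℂ) • 1) *ᵥ v =
      (A - (μs : ℂ) • C - (lams : ℂ) • 1) *ᵥ v - ((μ - μs : ℝ) : ℂ) • (C *ᵥ v)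
        - ((lam - lams : ℝ) : ℂ) • v := by
    simp only [Matrix.sub_mulVec, smul_mulVec, one_mulVec]
    push_cast
    module
  have hxg : x.ofLp - g.ofLp = (x - g).ofLp := rfl
  have hdn (c d : ℝ) (hc : |c| ≤ ε) (hd : |d| ≤ ε) (v : Fin n → ℂ) :
      ‖WithLp.toLp 2 ((c : ℂ) • (C *ᵥ v) + (d : ℂ) • v)‖ ≤
        ε * ((‖C‖ + 1) * ‖WithLp.toLp 2 v‖) := by
    rw [WithLp.toLp_add, WithLp.toLp_smul, WithLp.toLp_smul]
    refine (norm_add_le _ _).trans ?_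
    rw [norm_smul, norm_smul, Complex.norm_real, Complex.norm_real, Real.norm_eq_abs,
      Real.norm_eq_abs]
    calc _ ≤ ε * (‖C‖ * ‖WithLp.toLp 2 v‖) + ε * ‖WithLp.toLp 2 v‖ := by
          gcongr
          exact norm_toLp_mulVec_le C v
      _ = _ := by ring
  obtain ⟨e, a, b, he, hen⟩ := hlift (((μ - μs : ℝ) : ℂ) • (C *ᵥ (x - g).ofLp) +
    ((lam - lams : ℝ) : ℂ) • (x - g).ofLp)
  obtain ⟨f, a', b', hf, hfn⟩ := hlift (-(((μ - μs : ℝ) : ℂ) • (C *ᵥ y) +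
    ((lam - lams : ℝ) : ℂ) • y) - t • (C *ᵥ (x - g).ofLp))
  refine ⟨e, f, ⟨-((μ - μs : ℝ) : ℂ) - a, -((lam - lams : ℝ) : ℂ) - b, ?_⟩, ⟨t - a', -b', ?_⟩,
    ?_, ?_⟩
  · rw [mulVec_sub, hB g.ofLp, hg.sub_mulVec]
    rw [← hxg, mulVec_sub, sub_eq_iff_eq_add, sub_eq_iff_eq_add] at he
    rw [he]
    module
  · rw [mulVec_sub, hB y, hy]
    rw [← hxg, mulVec_sub, sub_eq_iff_eq_add, sub_eq_iff_eq_add] at hf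
    rw [hf]
    module
  · refine hen.trans ?_
    have := hdn _ _ hμ hlam (x - g).ofLp
    rw [WithLp.toLp_ofLp] at this
    calc _ ≤ M * (ε * ((‖C‖ + 1) * ε)) := by gcongr; exact this.trans (by gcongr)
      _ = _ := by ring
  · refine hfn.trans ?_
    have h1 := hdn _ _ hμ hlam y
    have h2 : ‖WithLp.toLp 2 (t • (C *ᵥ (x - g).ofLp))‖ ≤ ‖t‖ * (‖C‖ * ε) := by
      rw [WithLp.toLp_smul, norm_smul]
      gcongr
      refine (norm_toLp_mulVec_le C _).trans ?_
      rw [WithLp.toLp_ofLp]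
      gcongr
    rw [WithLp.toLp_sub, WithLp.toLp_neg]
    calc _ ≤ M * (ε * ((‖C‖ + 1) * ‖WithLp.toLp 2 y‖) + ‖t‖ * (‖C‖ * ε)) := by
          gcongr
          refine (norm_sub_le _ _).trans ?_
          rw [norm_neg]
          gcongr
      _ = _ := by ring

lemma IsProjectionMatrix.exists_mulVec_eq {μ lam : ℝ} {x : EuclideanSpace ℂ (Fin n)}
    (h : IsProjectionMatrix A C μ lam x V) {v : Fin n → ℂ}
    (hv : ∃ a b : ℂ, (A - (μ : ℂ) • C - (lam : ℂ) • 1) *ᵥ v - a • (C *ᵥ x.ofLp) - b • x.ofLp = 0) :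
    ∃ p, v = V *ᵥ p := by
  have := (mem_projection_iff (A := A) (C := C) μ lam x v).2 hv
  rw [← h.span] at this
  obtain ⟨p, hp⟩ := this
  exact ⟨p, hp.symm⟩

/-- The hypotheses fall into two groups: `ε` small enough for the nondegeneracy of `q` and for the
separation of the Ritz values, and `K` large enough to absorb every other constant. -/
lemma exists_nearer_ritz {μs lams μ lam ε K E₁ E₂ : ℝ} {g x : EuclideanSpace ℂ (Fin n)}
    {y e f : Fin n → ℂ} {t : ℂ}
    (hA : A.IsHermitian) (hC : C.IsHermitian)
    (hg : IsEigentriplet A C μs lams g) (hgy : star g.ofLp ⬝ᵥ (C *ᵥ y) = 1)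
    (hyy : star y ⬝ᵥ ((A - (μs : ℂ) • C - (lams : ℂ) • 1) *ᵥ y) = t)
    (hP : IsProjectionMatrix A C μ lam x V)
    (hμ : |μ - μs| ≤ ε) (hlam : |lam - lams| ≤ ε)
    (he : ∃ a b : ℂ, (A - (μ : ℂ) • C - (lam : ℂ) • 1) *ᵥ (g.ofLp - e) - a • (C *ᵥ x.ofLp)
        - b • x.ofLp = 0)
    (hf : ∃ a b : ℂ, (A - (μ : ℂ) • C - (lam : ℂ) • 1) *ᵥ (y - f) - a • (C *ᵥ x.ofLp)
        - b • x.ofLp = 0)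
    (hen : ‖WithLp.toLp 2 e‖ ≤ E₁ * ε ^ 2) (hfn : ‖WithLp.toLp 2 f‖ ≤ E₂ * ε)
    (hε : 0 ≤ ε) (hε1 : ε ≤ 1) (hE₁ : E₁ * ε ≤ 1) (hE₂ : E₂ * ε ≤ 1) (hE₁0 : 0 ≤ E₁)
    (ht : t ≠ 0)
    (hCε : 2 * ‖C‖ * (E₂ + E₁ * ‖WithLp.toLp 2 y‖ + E₁) * ε ≤ 1)
    (hBε : 2 / ‖t‖ * ‖A - (μs : ℂ) • C - (lams : ℂ) • 1‖ * (2 * ‖WithLp.toLp 2 y‖ + 1) * E₂ * ε ≤ 1)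
    (hK : 1 ≤ K) (hK1 : ‖C‖ ≤ K) (hK2 : ‖A - (μs : ℂ) • C - (lams : ℂ) • 1‖ ≤ K)
    (hK3 : 3 * ‖C‖ * E₁ ≤ K) (hK4 : 3 * E₁ ≤ K)
    (hK5 : ‖A - (μs : ℂ) • C - (lams : ℂ) • 1‖ * E₁ ≤ K) (hK6 : ‖WithLp.toLp 2 y‖ + 1 ≤ K)
    (hK7 : 2 / ‖t‖ ≤ K) (hKε : 16 * (32 * K ^ 3) ^ 7 * ε ≤ 1)
    (hgap : 72 * (32 * K ^ 3) ^ 9 * (2 + 400 * (32 * K ^ 3) ^ 10) * ε < 1) :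
    0 < c₁ C V ∧ c₂ C V < 0 ∧ a₁₂ A V ≠ 0 ∧ ∃ α ∈ ritzAlphas A V,
      ritzGap A C V μ lam α < ritzGap A C V μ lam (-α) ∧
      ∃ ν θ : ℝ, ritzNu A C V α = ν ∧ ritzTheta A C V α = θ ∧
        |ν - μs| ≤ 200 * (32 * K ^ 3) ^ 10 * ε ^ 2 ∧
        |θ - lams| ≤ ‖A - (μs : ℂ) • C - (lams : ℂ) • 1‖ *
          (200 * (32 * K ^ 3) ^ 7 + E₁) ^ 2 * ε ^ 4 ∧
        Metric.infDist (ritzVec C V α) (eigenvectorSet A C μs lams) ≤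
          (200 * (32 * K ^ 3) ^ 7 + E₁) * ε ^ 2 := by
  have hK0 : 0 < K := by linarith
  have ht0 : 0 < ‖t‖ := norm_pos_iff.2 ht
  have hεε : ε ^ 2 ≤ ε := by nlinarith only [hε, hε1]
  set B := A - (μs : ℂ) • C - (lams : ℂ) • 1 with hBdef
  have hen1 : ‖WithLp.toLp 2 e‖ ≤ E₁ * ε := hen.trans (by gcongr)
  have hen2 : ‖WithLp.toLp 2 e‖ ≤ 1 := hen1.trans hE₁
  have hfn2 : ‖WithLp.toLp 2 f‖ ≤ 1 := hfn.trans hE₂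
  have hgn : ‖WithLp.toLp 2 g.ofLp‖ = 1 := hg.norm_eq
  have hBg : B *ᵥ g.ofLp = 0 := hg.sub_mulVec
  have hee : ‖WithLp.toLp 2 e‖ * ‖WithLp.toLp 2 e‖ ≤ ‖WithLp.toLp 2 e‖ := by
    nlinarith only [hen2, norm_nonneg (WithLp.toLp 2 e)]
  have hff : ‖WithLp.toLp 2 f‖ * ‖WithLp.toLp 2 f‖ ≤ ‖WithLp.toLp 2 f‖ := by
    nlinarith only [hfn2, norm_nonneg (WithLp.toLp 2 f)]
  have hef : ‖WithLp.toLp 2 e‖ * ‖WithLp.toLp 2 f‖ ≤ ‖WithLp.toLp 2 e‖ := by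
    nlinarith only [hfn2, norm_nonneg (WithLp.toLp 2 e)]
  obtain ⟨p, hp⟩ := hP.exists_mulVec_eq he
  obtain ⟨q, hq⟩ := hP.exists_mulVec_eq hf
  -- The accuracy parameter is `ε²`, because every smallness condition concerns `p`, that is `g -
  -- e`; the vector `q`, known only to order `ε`, enters through lower bounds.
  have hpair := exists_ritz_pair (V := V) (p := p) (q := q) (δ := ε ^ 2) (μs := μs) (lams := lams)
    hA hC hK (sq_nonneg ε) (by
      refine le_trans ?_ hKε
      gcongr) hP.orthonormal hP.diag hP.order hK1 hK2 (by
      rw [← hq, WithLp.toLp_sub]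
      refine (norm_sub_le _ _).trans (le_trans ?_ hK6)
      gcongr) (by
      rw [← hp, WithLp.toLp_sub]
      have h1 := abs_norm_sub_norm_le (WithLp.toLp 2 g.ofLp - WithLp.toLp 2 e) (WithLp.toLp 2 g.ofLp)
      rw [sub_sub_cancel_left, norm_neg, hgn] at h1
      set m := ‖WithLp.toLp 2 g.ofLp - WithLp.toLp 2 e‖
      obtain ⟨l1, l2⟩ := abs_le.1 h1
      calc |m ^ 2 - 1| = |m - 1| * |m + 1| := by rw [← abs_mul]; congr 1; ring
        _ ≤ ‖WithLp.toLp 2 e‖ * 3 := by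
          gcongr
          rw [abs_le]; constructor <;> linarith
        _ ≤ E₁ * ε ^ 2 * 3 := by gcongr
        _ = 3 * E₁ * ε ^ 2 := by ring
        _ ≤ _ := by gcongr) (by
      rw [← hp]
      have h1 := norm_dotProduct_sub_mulVec_sub_le C g.ofLp g.ofLp e e
      rw [hg.form, sub_zero, hgn] at h1
      calc _ ≤ _ := h1
        _ ≤ ‖C‖ * (1 * (E₁ * ε ^ 2) + (E₁ * ε ^ 2) * 1 + E₁ * ε ^ 2) := by
          refine mul_le_mul_of_nonneg_left (add_le_add (add_le_add ?_ ?_) (hee.trans hen))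
            (norm_nonneg _) <;> gcongr
        _ = 3 * ‖C‖ * E₁ * ε ^ 2 := by ring
        _ ≤ _ := by gcongr) (by
      rw [← hp, ← hq]
      have h1 := norm_dotProduct_sub_mulVec_sub_le C g.ofLp y e f
      rw [hgy, hgn, norm_sub_rev] at h1
      have h2 := norm_sub_norm_le (1 : ℂ) (star (g.ofLp - e) ⬝ᵥ (C *ᵥ (y - f)))
      have h3 : ‖C‖ * (1 * ‖WithLp.toLp 2 f‖ + ‖WithLp.toLp 2 e‖ * ‖WithLp.toLp 2 y‖ +
          ‖WithLp.toLp 2 e‖ * ‖WithLp.toLp 2 f‖) ≤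
          ‖C‖ * (1 * (E₂ * ε) + E₁ * ε * ‖WithLp.toLp 2 y‖ + E₁ * ε) := by
        refine mul_le_mul_of_nonneg_left (add_le_add (add_le_add ?_ ?_) (hef.trans hen1))
          (norm_nonneg _) <;> gcongr
      rw [norm_one] at h2
      linarith) (by
      rw [← hp, mulVec_sub, hBg, zero_sub, WithLp.toLp_neg, norm_neg]
      calc _ ≤ ‖B‖ * ‖WithLp.toLp 2 e‖ := norm_toLp_mulVec_le _ _
        _ ≤ ‖B‖ * (E₁ * ε ^ 2) := by gcongr
        _ = ‖B‖ * E₁ * ε ^ 2 := by ring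
        _ ≤ _ := by gcongr) (by
      rw [← hq]
      have h1 := norm_dotProduct_sub_mulVec_sub_le B y y f f
      rw [hyy, norm_sub_rev] at h1
      have h2 := norm_sub_norm_le t (star (y - f) ⬝ᵥ (B *ᵥ (y - f)))
      have h3 : ‖B‖ * (‖WithLp.toLp 2 y‖ * ‖WithLp.toLp 2 f‖ +
          ‖WithLp.toLp 2 f‖ * ‖WithLp.toLp 2 y‖ + ‖WithLp.toLp 2 f‖ * ‖WithLp.toLp 2 f‖) ≤
          ‖B‖ * (‖WithLp.toLp 2 y‖ * (E₂ * ε) + E₂ * ε * ‖WithLp.toLp 2 y‖ + E₂ * ε) := by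
        refine mul_le_mul_of_nonneg_left (add_le_add (add_le_add ?_ ?_) (hff.trans hfn))
          (norm_nonneg _) <;> gcongr
      have h4 := mul_le_mul_of_nonneg_left hBε (show 0 ≤ ‖t‖ / 2 by positivity)
      have h5 : ‖t‖ / 2 * (2 / ‖t‖ * ‖B‖ * (2 * ‖WithLp.toLp 2 y‖ + 1) * E₂ * ε) =
          ‖B‖ * (2 * ‖WithLp.toLp 2 y‖ + 1) * E₂ * ε := by field_simp
      rw [h5] at h4
      have h6 : 1 / K ≤ ‖t‖ / 2 := by
        rw [div_le_iff₀ ht0] at hK7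
        rw [div_le_div_iff₀ hK0 (by norm_num)]
        linarith
      linarith)
  obtain ⟨h1, h2, h3, α, hα, ν, θ, ν', θ', hν, hθ, hν', hθ', hνe, hθe, hsep, hθx, γ, hγ, hpγ⟩ :=
    hpair
  set L := 32 * K ^ 3
  have hL1 : 1 ≤ L := by
    have := one_le_pow₀ hK (n := 3)
    linarith
  have hL0 : 0 < L := by linarith
  have hγ0 : γ ≠ 0 := by rintro rfl; simp at hγ
  have hxg : ‖γ • ritzVec C V α - g‖ ≤ (200 * L ^ 7 + E₁) * ε ^ 2 := by
    have e1 : γ • ritzVec C V α - g =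
        -(WithLp.toLp 2 (V *ᵥ p) - γ • ritzVec C V α) - WithLp.toLp 2 e := by
      rw [← hp, WithLp.toLp_sub, WithLp.toLp_ofLp]; abel
    rw [e1]
    refine (norm_sub_le _ _).trans ?_
    rw [norm_neg]
    linarith
  refine ⟨h1, h2, h3, α, hα, ?_, ν, θ, hν, hθ, hνe, ?_, ?_⟩
  · rw [ritzGap, ritzGap, hν, hθ, hν', hθ']
    simp only [← Complex.ofReal_sub, Complex.norm_real, Real.norm_eq_abs]
    have g1 : |μ - ν| ≤ ε + 200 * L ^ 10 * ε := by
      calc |μ - ν| = |(μ - μs) - (ν - μs)| := by congr 1; ring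
        _ ≤ |μ - μs| + |ν - μs| := abs_sub _ _
        _ ≤ ε + 200 * L ^ 10 * ε ^ 2 := by gcongr
        _ ≤ _ := by gcongr
    have g2 : |lam - θ| ≤ ε + 200 * L ^ 10 * ε := by
      calc |lam - θ| = |(lam - lams) - (θ - lams)| := by congr 1; ring
        _ ≤ |lam - lams| + |θ - lams| := abs_sub _ _
        _ ≤ ε + 200 * L ^ 7 * ε ^ 2 := by gcongr
        _ ≤ ε + 200 * L ^ 10 * ε := by gcongr ; norm_num
    have g3 : |θ - θ'| ≤ |lam - θ| + |lam - θ'| := by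
      calc |θ - θ'| = |(lam - θ') - (lam - θ)| := by congr 1; ring
        _ ≤ _ := by rw [add_comm]; exact abs_sub _ _
    -- Twice the gap of the good triplet stays below the separation of the Ritz values, so the other
    -- triplet is strictly farther already in its `θ` component.
    have g4 : 2 * ((2 + 400 * L ^ 10) * ε) < 1 / (36 * L ^ 9) := by
      rw [lt_div_iff₀ (by positivity)]
      linarith
    have g5 : 0 ≤ L ^ 10 * ε := by positivity
    have g6 := abs_nonneg (μ - ν')
    linarith
  -- Subtracting `g` does not change the quadratic form because `B g = 0` and `B` is Hermitian; this
  -- squares the `O(ε²)` vector error.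
  · have e1 : ((θ - lams : ℝ) : ℂ) = star (γ • ritzVec C V α - g).ofLp ⬝ᵥ
        (B *ᵥ (γ • ritzVec C V α - g).ofLp) := by
      have hgB (v : Fin n → ℂ) : star g.ofLp ⬝ᵥ (B *ᵥ v) = 0 := by
        have hB : B.IsHermitian := isHermitian_pencil hA hC μs lams
        rw [star_dotProduct, star_mulVec, hB.eq, ← dotProduct_mulVec, hBg]
        simp
      have hγγ : star γ * γ = 1 := by
        rw [Complex.star_def, ← Complex.normSq_eq_conj_mul_self, Complex.normSq_eq_norm_sq, hγ]
        simp
      rw [hθx, WithLp.ofLp_sub, WithLp.ofLp_smul, mulVec_sub, hBg, sub_zero, star_sub,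
        sub_dotProduct, hgB, sub_zero, mulVec_smul, star_smul, smul_dotProduct, dotProduct_smul,
        smul_smul, hγγ, one_smul]
    have e2 := norm_dotProduct_mulVec_le B (γ • ritzVec C V α - g).ofLp (γ • ritzVec C V α - g).ofLp
    rw [← e1, Complex.norm_real, Real.norm_eq_abs, WithLp.toLp_ofLp] at e2
    calc _ ≤ _ := e2
      _ ≤ ‖B‖ * ((200 * L ^ 7 + E₁) * ε ^ 2) * ((200 * L ^ 7 + E₁) * ε ^ 2) := by gcongr
      _ = _ := by ring
  · have hmem : γ⁻¹ • g ∈ eigenvectorSet A C μs lams := hg.smul (by rw [norm_inv, hγ, inv_one])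
    refine (Metric.infDist_le_dist_of_mem hmem).trans ?_
    rw [dist_eq_norm]
    refine le_trans (le_of_eq ?_) hxg
    have : γ • ritzVec C V α - g = γ • (ritzVec C V α - γ⁻¹ • g) := by
      rw [smul_sub, smul_smul, mul_inv_cancel₀ hγ0, one_smul]
    rw [this, norm_smul, hγ, one_mul]

/-! ### Choice of the constants and conclusion. -/

lemma IsNonsingularSimple.exists_local_constants {μs lams : ℝ} {xs : EuclideanSpace ℂ (Fin n)}
    (hA : A.IsHermitian) (hC : C.IsHermitian) (h : IsNonsingularSimple A C μs lams xs) :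
    ∃ ε₀ κ₁ κ₂ κ₃ : ℝ, 0 < ε₀ ∧ 0 < κ₁ ∧ 0 < κ₂ ∧ 0 < κ₃ ∧
      ∀ (μ lam : ℝ) (x : EuclideanSpace ℂ (Fin n)), err A C μs lams μ lam x ≤ ε₀ →
        IsUnit (jacobian A C μ lam x).det ∧
        ∀ V, IsProjectionMatrix A C μ lam x V →
          0 < c₁ C V ∧ c₂ C V < 0 ∧ a₁₂ A V ≠ 0 ∧ ∃ α ∈ ritzAlphas A V,
            ritzGap A C V μ lam α < ritzGap A C V μ lam (-α) ∧
            ∃ ν θ : ℝ, ritzNu A C V α = ν ∧ ritzTheta A C V α = θ ∧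
              |ν - μs| ≤ κ₁ * err A C μs lams μ lam x ^ 2 ∧
              |θ - lams| ≤ κ₂ * err A C μs lams μ lam x ^ 4 ∧
              Metric.infDist (ritzVec C V α) (eigenvectorSet A C μs lams) ≤
                κ₃ * err A C μs lams μ lam x ^ 2 := by
  obtain ⟨y, t, ht, hxy, hBy, hyy⟩ := h.exists_second_direction hA hC
  obtain ⟨M, hM, η, hη, hlift⟩ := exists_lift_bound h.nonsingular
  have ht0 : 0 < ‖t‖ := norm_pos_iff.2 ht
  obtain ⟨N, hN⟩ : ∃ N, N = ‖C‖ := ⟨_, rfl⟩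
  obtain ⟨b, hb⟩ : ∃ b, b = ‖A - (μs : ℂ) • C - (lams : ℂ) • 1‖ := ⟨_, rfl⟩
  obtain ⟨Y, hY⟩ : ∃ Y, Y = ‖WithLp.toLp 2 y‖ := ⟨_, rfl⟩
  have hN0 : 0 ≤ N := hN ▸ norm_nonneg _
  have hb0 : 0 ≤ b := hb ▸ norm_nonneg _
  have hY0 : 0 ≤ Y := hY ▸ norm_nonneg _
  obtain ⟨E₁, hE₁⟩ : ∃ E₁, E₁ = M * (N + 1) := ⟨_, rfl⟩
  obtain ⟨E₂, hE₂⟩ : ∃ E₂, E₂ = M * ((N + 1) * Y + ‖t‖ * N) := ⟨_, rfl⟩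
  have hE₁0 : 0 ≤ E₁ := by rw [hE₁]; positivity
  have hE₂0 : 0 ≤ E₂ := by rw [hE₂]; positivity
  obtain ⟨K, hK⟩ : ∃ K, K = 1 + N + b + 3 * N * E₁ + 3 * E₁ + b * E₁ + (Y + 1) + 2 / ‖t‖ := ⟨_, rfl⟩
  have n1 : 0 ≤ 3 * N * E₁ := by positivity
  have n2 : 0 ≤ b * E₁ := by positivity
  have n3 : 0 ≤ 2 / ‖t‖ := by positivity
  have hK1 : 1 ≤ K := by linarith
  have hK0 : 0 < K := by linarith
  -- A sum of nonnegative terms dominates each of them, so `ε ≤ 1/Q` meets all smallness conditions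
  -- at once. The factors 2 at `2 / η` and in the last term turn `≤` into the strict inequalities
  -- needed.
  obtain ⟨Q, hQ⟩ : ∃ Q, Q = 1 + 2 / η + E₁ + E₂ + 2 * N * (E₂ + E₁ * Y + E₁) +
    2 / ‖t‖ * b * (2 * Y + 1) * E₂ + 16 * (32 * K ^ 3) ^ 7 +
    2 * (72 * (32 * K ^ 3) ^ 9 * (2 + 400 * (32 * K ^ 3) ^ 10)) := ⟨_, rfl⟩
  have m1 : 0 ≤ 2 / η := by positivity
  have m2 : 0 ≤ 2 * N * (E₂ + E₁ * Y + E₁) := by positivity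
  have m3 : 0 ≤ 2 / ‖t‖ * b * (2 * Y + 1) * E₂ := by positivity
  have m4 : 0 ≤ 16 * (32 * K ^ 3) ^ 7 := by positivity
  have m5 : 0 ≤ 2 * (72 * (32 * K ^ 3) ^ 9 * (2 + 400 * (32 * K ^ 3) ^ 10)) := by positivity
  have hQ0 : 0 < Q := by linarith
  -- The added 1 keeps `κ₂` positive when `b = 0`.
  refine ⟨1 / Q, 200 * (32 * K ^ 3) ^ 10, b * (200 * (32 * K ^ 3) ^ 7 + E₁) ^ 2 + 1,
    200 * (32 * K ^ 3) ^ 7 + E₁, by positivity, by positivity, by positivity, by positivity,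
    fun μ lam x hε => ?_⟩
  obtain ⟨ε, hεe⟩ : ∃ ε, ε = err A C μs lams μ lam x := ⟨_, rfl⟩
  rw [← hεe] at hε ⊢
  have hμ : |μ - μs| ≤ ε := hεe ▸ (le_max_left _ _).trans (le_max_left _ _)
  have hlam : |lam - lams| ≤ ε := hεe ▸ (le_max_right _ _).trans (le_max_left _ _)
  have hdist : Metric.infDist x (eigenvectorSet A C μs lams) ≤ ε := hεe ▸ le_max_right _ _
  have hε0 : 0 ≤ ε := (abs_nonneg _).trans hμ
  have small (c : ℝ) (hc : c ≤ Q) : c * ε ≤ 1 := by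
    calc c * ε ≤ Q * (1 / Q) := by gcongr
      _ = 1 := by field_simp
  obtain ⟨g, hg, hxg⟩ := (isClosed_eigenvectorSet (A := A) (C := C) μs lams).exists_infDist_eq_dist
    ⟨xs, h.triplet⟩ x
  rw [hxg, dist_eq_norm] at hdist
  -- By simplicity the nearest 2D-eigenvector is a unit multiple of `xs`. The lift bound near `xs`
  -- applies to `γ⁻¹ • x`, and rescaling its coefficients by `γ⁻¹` returns it to `x` with the same
  -- `M`.
  obtain ⟨γ, hγ, rfl⟩ := h.exists_rotation hg
  have hγ0 : γ ≠ 0 := by rintro rfl; simp at hγ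
  have hγγ : star γ * γ = 1 := by
    rw [Complex.star_def, ← Complex.normSq_eq_conj_mul_self, Complex.normSq_eq_norm_sq, hγ]; simp
  have hεη : ε < η := by
    have := small (2 / η) (by linarith)
    rw [div_mul_eq_mul_div, div_le_one hη] at this
    linarith
  have hrot : x = γ • (γ⁻¹ • x) := by rw [smul_smul, mul_inv_cancel₀ hγ0, one_smul]
  have hx0 : ‖γ⁻¹ • x - xs‖ < η := by
    refine lt_of_le_of_lt ?_ (lt_of_le_of_lt hdist hεη)
    nth_rewrite 2 [hrot]
    rw [← smul_sub, norm_smul, hγ, one_mul]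
  obtain ⟨hdet, hl⟩ := hlift μ lam (γ⁻¹ • x) (hμ.trans_lt hεη) (hlam.trans_lt hεη) hx0
  have hl' (r : Fin n → ℂ) : ∃ (e : Fin n → ℂ) (a b : ℂ),
      (A - (μ : ℂ) • C - (lam : ℂ) • 1) *ᵥ e - a • (C *ᵥ x.ofLp) - b • x.ofLp = r ∧
        ‖WithLp.toLp 2 e‖ ≤ M * ‖WithLp.toLp 2 r‖ := by
    obtain ⟨e, a, b, he, hen⟩ := hl r
    refine ⟨e, a * γ⁻¹, b * γ⁻¹, ?_, hen⟩
    rw [← he, WithLp.ofLp_smul, mulVec_smul, smul_smul, smul_smul]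
  refine ⟨by rw [hrot]; exact isUnit_det_jacobian_smul hγ hdet, fun V hV => ?_⟩
  have hγy : ‖WithLp.toLp 2 (γ • y)‖ = Y := by
    rw [WithLp.toLp_smul, norm_smul, hγ, one_mul, hY]
  have hBγ : (A - (μs : ℂ) • C - (lams : ℂ) • 1) *ᵥ (γ • y) = t • (C *ᵥ (γ • xs).ofLp) := by
    rw [mulVec_smul, hBy, WithLp.ofLp_smul, mulVec_smul, smul_comm]
  obtain ⟨e, f, he, hf, hen, hfn⟩ := exists_near_projection hM.le hε0 hg hBγ hl' hμ hlam hdist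
  rw [hγy, ← hN, ← hE₂] at hfn
  rw [← hN, ← hE₁] at hen
  obtain ⟨r1, r2, r3, α, hα, hgap, ν, θ, hν, hθ, e1, e2, e3⟩ := exists_nearer_ritz (K := K) hA hC hg
    (by rw [WithLp.ofLp_smul, mulVec_smul, star_smul, smul_dotProduct, dotProduct_smul,
      smul_smul, hγγ, one_smul, hxy])
    (by rw [mulVec_smul, star_smul, smul_dotProduct, dotProduct_smul, smul_smul, hγγ, one_smul,
      hyy]) hV hμ hlam he hf hen hfn hε0 (by simpa using small 1 (by linarith))
    (small _ (by linarith)) (small _ (by linarith)) hE₁0 ht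
    (by rw [hγy, ← hN]; exact small _ (by linarith))
    (by rw [hγy, ← hb]; exact small _ (by linarith)) hK1 (by rw [← hN]; linarith)
    (by rw [← hb]; linarith) (by rw [← hN]; linarith) (by linarith) (by rw [← hb]; linarith)
    (by rw [hγy]; linarith) (by linarith) (small _ (by linarith))
    (by have := small _ (show 2 * (72 * (32 * K ^ 3) ^ 9 * (2 + 400 * (32 * K ^ 3) ^ 10)) ≤ Q by
          linarith)
        linarith)
  refine ⟨r1, r2, r3, α, hα, hgap, ν, θ, hν, hθ, e1, ?_, e3⟩
  refine e2.trans ?_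
  rw [← hb]
  gcongr
  linarith

lemma eq_or_eq_neg_of_mem_ritzAlphas {α β : ℂ} (hα : α ∈ ritzAlphas A V)
    (hβ : β ∈ ritzAlphas A V) : β = α ∨ β = -α := by
  rcases hα with rfl | rfl <;> rcases hβ with rfl | rfl <;> simp

end TwoDEVP
end
theorem theorem5p5 {n : ℕ} (A C : Matrix (Fin n) (Fin n) ℂ)
    (hA : A.IsHermitian) (hC : C.IsHermitian) (hCind : TwoDEVP.IsIndefinite C)
    (μs lams : ℝ) :
    ∃ ε₀ κ₁ κ₂ κ₃ : ℝ, 0 < ε₀ ∧ 0 < κ₁ ∧ 0 < κ₂ ∧ 0 < κ₃ ∧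
      ∀ xs : EuclideanSpace ℂ (Fin n), TwoDEVP.IsNonsingularSimple A C μs lams xs →
      ∀ (μ lam : ℝ) (x : EuclideanSpace ℂ (Fin n)),
        TwoDEVP.err A C μs lams μ lam x ≤ ε₀ →
        -- the step can be carried out
        IsUnit (TwoDEVP.jacobian A C μ lam x).det ∧
        (∃ V, TwoDEVP.IsProjectionMatrix A C μ lam x V) ∧
        ∀ V, TwoDEVP.IsProjectionMatrix A C μ lam x V →
          0 < TwoDEVP.c₁ C V ∧ TwoDEVP.c₂ C V < 0 ∧
          (∃ μ' lam' x', TwoDEVP.IsStep A C V μ lam x μ' lam' x') ∧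
          -- the generic case occurs, and one 2D-Ritz triplet is strictly nearer
          TwoDEVP.a₁₂ A V ≠ 0 ∧
          (∃ α ∈ TwoDEVP.ritzAlphas A V,
            TwoDEVP.ritzGap A C V μ lam α < TwoDEVP.ritzGap A C V μ lam (-α)) ∧
          ∀ (μ' lam' : ℝ) (x' : EuclideanSpace ℂ (Fin n)),
            TwoDEVP.IsStep A C V μ lam x μ' lam' x' →
            TwoDEVP.IsGenericUpdate A C V μ lam μ' lam' x' ∧
            |μ' - μs| ≤ κ₁ * TwoDEVP.err A C μs lams μ lam x ^ 2 ∧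
            |lam' - lams| ≤ κ₂ * TwoDEVP.err A C μs lams μ lam x ^ 4 ∧
            Metric.infDist x' (TwoDEVP.eigenvectorSet A C μs lams) ≤
              κ₃ * TwoDEVP.err A C μs lams μ lam x ^ 2 := by
  -- The constants must not depend on `xs`. One nonsingular simple representative supplies them,
  -- since `err` refers only to the whole set of 2D-eigenvectors.
  by_cases hex : ∃ xs, TwoDEVP.IsNonsingularSimple A C μs lams xs
  swap
  · exact ⟨1, 1, 1, 1, one_pos, one_pos, one_pos, one_pos, fun xs hxs => absurd ⟨xs, hxs⟩ hex⟩
  obtain ⟨x₀, hx₀⟩ := hex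
  obtain ⟨ε₀, κ₁, κ₂, κ₃, h0, h1, h2, h3, H⟩ := hx₀.exists_local_constants hA hC
  refine ⟨ε₀, κ₁, κ₂, κ₃, h0, h1, h2, h3, fun _ _ μ lam x hε => ?_⟩
  obtain ⟨hJ, HV⟩ := H μ lam x hε
  refine ⟨hJ, TwoDEVP.exists_isProjectionMatrix hC hJ, fun V hV => ?_⟩
  obtain ⟨hc1, hc2, ha, α, hα, hgap, ν, θ, hν, hθ, e1, e2, e3⟩ := HV V hV
  refine ⟨hc1, hc2, ⟨ν, θ, TwoDEVP.ritzVec C V α, hJ, hV, hc1, hc2, Or.inl ⟨ha, α, hα, ?_, hν.symm,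
    hθ.symm, rfl⟩⟩, ha, ⟨α, hα, hgap⟩, fun μ' lam' x' hstep => ?_⟩
  · intro β hβ
    rcases TwoDEVP.eq_or_eq_neg_of_mem_ritzAlphas hα hβ with rfl | rfl
    · exact le_rfl
    · exact hgap.le
  · rcases hstep.update with hu | hu
    swap
    · exact absurd hu.1 ha
    refine ⟨hu, ?_⟩
    obtain ⟨-, β, hβ, hmin, hμ', hlam', rfl⟩ := hu
    rcases TwoDEVP.eq_or_eq_neg_of_mem_ritzAlphas hα hβ with rfl | rfl
    · rw [hν] at hμ'
      rw [hθ] at hlam'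
      rw [Complex.ofReal_injective hμ', Complex.ofReal_injective hlam']
      exact ⟨e1, e2, e3⟩
    · exact absurd (hmin α hα) (not_le.2 hgap)
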